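/- Let $\mathcal F$ be a separable real Hilbert space and let $(X_i,Y_i)_{i\ge 1}$ be independent copies of an $\mathcal F\times\mathbb R$-valued random pair $(X,Y)$, where $X$ is centered, nonatomic (every point has probability $0$) and has bounded support, and $Y$ is bounded. Denote by $\mu$ the distribution of $X$, by $\Gamma=\mathbb E[\langle X,\cdot\rangle X]$ its covariance operator and by $\Gamma_n=\frac1n\sum_{i=1}^n\langle X_i,\cdot\rangle X_i$ the empirical covariance operator. Fix an integer $D>2$. Let $\lambda_1\ge\lambda_2\ge\cdots$ be the eigenvalues of $\Gamma$, counted with multiplicity, and assume $\lambda_1>\cdots>\lambda_D>\lambda_{D+1}$ (if $\dim\mathcal F=D$, the last inequality is dropped). Let $\Pi_D$ be the orthogonal projector onto the span of the eigenvectors of $\Gamma$ associated with $\lambda_1,\dots,\lambda_D$, and let $\hat\Pi_D=\hat\Pi_{D,n}$ be a (measurable) orthogonal projector onto the span of $D$ orthonormal eigenvectors of $\Gamma_n$ associated with its $D$ largest eigenvalues, counted with multiplicity. Let $K:[0,\infty)\to[0,\infty)$ be bounded with support $[0,1]$ and of class $\mathcal C^1$ on $[0,1]$. For $x\in\mathcal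 F$ and $h>0$ put $F_x(h)=\mathbb P(\|\Pi_D X-\Pi_D x\|\le h)$, let $r^D(x)=\mathbb E[Y\mid \Pi_DX=\Pi_Dx]$ (any fixed version, that is, $r^D=\rho\circ\Pi_D$ with $\rho$ measurable and $\mathbb E[Y\mid\Pi_DX]=\rho(\Pi_DX)$ a.s.), and, for a sequence $(h_n)$ of positive numbers, $$Z_n(x)=\sum_{i=1}^nY_iK\!\left(\frac{\|\Pi_D(x-X_i)\|}{h_n}\right),\qquad \hat Z_n(x)=\sum_{i=1}^nY_iK\!\left(\frac{\|\hat\Pi_D(x-X_i)\|}{h_n}\right).$$ Then for $\mu$-almost every $x$ the following holds. If $F_x$ is regularly varying at $0$ with index $D$, that is, $\lim_{s\to0^+}F_x(su)/F_x(s)=u^D$ for every $u>0$, if $r^D(x)\ne0$ and if $r^D$ is Lipschitz in a neighborhood of $x$, then for every sequence of positive numbers $h_n\to0$ with $nF_x(h_n)/\ln n\to\infty$, $$\hat Z_n(x)\sim Z_n(x)\quad\text{almost surely}\qquad\text{and}\qquad \mathbb E\hat Z_n^2(x)\sim\mathbb EZ_n^2(x)\qquad\text{as }n\to\infty .$$ 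-/

import Mathlib

open MeasureTheory ProbabilityTheory Filter Topology Asymptotics

noncomputable section

namespace PCA

variable {Ω F : Type*} [MeasurableSpace Ω] [NormedAddCommGroup F] [InnerProductSpace ℝ F]

/-- The covariance operator `Γ u = E[⟨X, u⟩ X]` of a (centered) random element `X`. -/
def covOp (P : Measure Ω) (X : Ω → F) (u : F) : F :=
  ∫ ω, (inner ℝ (X ω) u : ℝ) • X ω ∂P

/-- The empirical covariance operator `Γₙ u = (1/n) ∑_{i<n} ⟨Xᵢ, u⟩ Xᵢ` of the sample
at the outcome `ω`; the sample of size `n` is `X 0, …, X (n-1)`. -/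
def empCovOp (X : ℕ → Ω → F) (n : ℕ) (ω : Ω) (u : F) : F :=
  (n : ℝ)⁻¹ • ∑ i ∈ Finset.range n, (inner ℝ (X i ω) u : ℝ) • X i ω

/-- `e` is a family of first `D` eigenvectors of `T`: it is orthonormal, `T e_i = lam_i e_i`, the
`lam_i` are sorted in decreasing order, and every eigenvalue left over (that is, one that has an
eigenvector orthogonal to all the `e_i`) is at most each `lam_i`. Eigenvalues are
counted with multiplicity. -/
structure IsLeadingEigensystem {D : ℕ} (T : F → F) (e : Fin D → F) (lam : Fin D → ℝ) : Prop where
  orthonormal : Orthonormal ℝ e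
  eigen : ∀ i, T (e i) = lam i • e i
  antitone : Antitone lam
  maximal : ∀ (v : F) (ν : ℝ), v ≠ 0 → (∀ j, (inner ℝ (e j) v : ℝ) = 0) → T v = ν • v →
    ∀ i, ν ≤ lam i

/-- `lam_1 > … > lam_D > lam_{D+1}`, where `lam_{D+1}` is the largest eigenvalue left over
once the eigenvectors `e_1, …, e_D` are removed. -/
def HasSeparatedEigenvalues {D : ℕ} (T : F → F) (e : Fin D → F) (lam : Fin D → ℝ) : Prop :=
  StrictAnti lam ∧
    ∀ (v : F) (ν : ℝ), v ≠ 0 → (∀ j, (inner ℝ (e j) v : ℝ) = 0) → T v = ν • v → ∀ i, ν < lam i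

/-- The orthogonal projector onto the span of `e_1, …, e_D`. -/
def projector {D : ℕ} (e : Fin D → F) : F →L[ℝ] F :=
  haveI := FiniteDimensional.span_of_finite ℝ (Set.finite_range e)
  (Submodule.span ℝ (Set.range e)).starProjection

/-- `Q` is the orthogonal projector onto the span of first `D` eigenvectors of `T`. -/
def IsPCAProjector (D : ℕ) (T : F → F) (Q : F →L[ℝ] F) : Prop :=
  ∃ (e : Fin D → F) (lam : Fin D → ℝ), IsLeadingEigensystem T e lam ∧ Q = projector e

/-- The conditions on the kernel `K : [0, ∞) → [0, ∞)` (only the values of `K` on `[0, ∞)`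
matter): nonnegative and bounded with support `[0, 1]`, and of class `C¹` on `[0, 1]`. -/
structure IsKernel (K : ℝ → ℝ) : Prop where
  nonneg : ∀ v, 0 ≤ v → 0 ≤ K v
  bounded : ∃ C, ∀ v, 0 ≤ v → K v ≤ C
  support : closure {v | 0 ≤ v ∧ K v ≠ 0} = Set.Icc 0 1
  contDiffOn : ContDiffOn ℝ 1 K (Set.Icc 0 1)

/-- `F_x(h) = P(‖Q X - Q x‖ ≤ h)`. -/
def smallBall (P : Measure Ω) (X : Ω → F) (Q : F →L[ℝ] F) (x : F) (h : ℝ) : ℝ :=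
  P.real {ω | ‖Q (X ω) - Q x‖ ≤ h}

/-- `G` is regularly varying at `0` with index `D`. -/
def RegVaryingAtZero (G : ℝ → ℝ) (D : ℕ) : Prop :=
  ∀ u : ℝ, 0 < u → Tendsto (fun s => G (s * u) / G s) (𝓝[>] 0) (𝓝 (u ^ D))

/-- `ρ (Q X)` is a version of `E[Y | Q X]`, so that `x ↦ ρ (Q x)` is a version of the
regression function `x ↦ E[Y | Q X = Q x]`. -/
def IsRegression [MeasurableSpace F] (P : Measure Ω) (X : Ω → F) (Y : Ω → ℝ) (Q : F →L[ℝ] F)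
    (ρ : F → ℝ) : Prop :=
  Measurable ρ ∧
    P[Y | MeasurableSpace.comap (fun ω => Q (X ω)) inferInstance] =ᵐ[P] fun ω => ρ (Q (X ω))

/-- The weighted kernel sum `∑_{i<n} Yᵢ K(‖Q (x - Xᵢ)‖ / h)` at the outcome `ω`. -/
def kernelSum (K : ℝ → ℝ) (X : ℕ → Ω → F) (Y : ℕ → Ω → ℝ) (Q : F →L[ℝ] F) (x : F) (h : ℝ)
    (n : ℕ) (ω : Ω) : ℝ :=
  ∑ i ∈ Finset.range n, Y i ω * K (‖Q (x - X i ω)‖ / h)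

end PCA

end

/-! Fix x and write h = h_n and g = F_x(h_n). Both sums live at the scale n g, which tends to
infinity, and the theorem follows from two estimates valid up to probability O(n⁻²): Z_n is within ε
n g of its mean, and Ẑ_n is within ε n g of Z_n. The mean has exact order n g, because r^D is
nonzero and continuous at x and K is bounded below on some interval
(`exists_abs_integral_mul_kernel_ge`). Borel–Cantelli gives the almost sure equivalence. For second
moments the exceptional event contributes only O(1), since the squares are O(n²)
(`isEquivalent_of_withHighProb`).

The comparison of Ẑ_n with Z_n rests on ‖Π̂_D − Π_D‖ ≤ η h. Regular variation with index D > 2 gives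
F_x(s) = O(s²) near 0, hence n h²/ln n → ∞ (`tendsto_sq_div_log_of_smallBall`): h dominates the
error √(ln n/n) of the empirical covariance. The arguments of K then move by an arbitrarily small
amount η. As K is uniformly continuous on [0,1] and zero beyond 1, only sample points projecting
near the sphere of radius h can change weight appreciably. Their number is at most about ((1+2η)^D −
(1−2η)^D) n g by regular variation, which is small against n g (`withHighProb_kernelSum_sub_le`).

The projector estimate is a Davis–Kahan argument (`norm_projector_sub_projector_le_of_gap`). It asks
for little: the residuals Γ_n e_j − λ_j e_j must be small at scale h for the D true eigenvectors,
and the quadratic form of Γ_n must stay below the spectral gap on their orthogonal complement. The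
second condition is one-sided and at fixed accuracy, so it reduces to finitely many vectors and one
scalar average. All deviations come from a single Bernstein inequality for Hilbert-space vectors
(`measureReal_norm_sum_ge_le`). -/

noncomputable section

namespace PCA

/-! ### Bernstein inequality in Hilbert space -/

section Bernstein

variable {Ω H : Type*} [MeasurableSpace Ω] {P : Measure Ω} [NormedAddCommGroup H]
  [InnerProductSpace ℝ H]

/-- The function √(1 + ‖s‖²) is a smooth substitute for ‖s‖, so its exponential grows by a term
linear in z plus a quadratic error. The linear term will vanish on averaging over a centered z. -/
lemma exp_sqrt_norm_add_le (s z : H) (hz : ‖z‖ ≤ 1 / 2) :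
    Real.exp (√(1 + ‖s + z‖ ^ 2)) ≤
      Real.exp (√(1 + ‖s‖ ^ 2)) *
        (1 + inner ℝ s z / √(1 + ‖s‖ ^ 2) + 3 * ‖z‖ ^ 2) := by
  set A := √(1 + ‖s‖ ^ 2) with hA
  have hA1 : 1 ≤ A := by
    rw [hA]; apply Real.one_le_sqrt.2; nlinarith [sq_nonneg ‖s‖]
  have hA0 : 0 < A := by linarith
  have hAsq : A ^ 2 = 1 + ‖s‖ ^ 2 := Real.sq_sqrt (by positivity)
  have hsA : ‖s‖ ≤ A := by
    rw [hA]; apply Real.le_sqrt_of_sq_le; linarith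
  have hz0 := norm_nonneg z
  set w := inner ℝ s z / A with hw
  have hwA : w * A = inner ℝ s z := by rw [hw]; field_simp
  have hwz : |w| ≤ ‖z‖ := by
    rw [hw, abs_div, abs_of_pos hA0, div_le_iff₀ hA0]
    calc |inner ℝ s z| ≤ ‖s‖ * ‖z‖ := abs_real_inner_le_norm s z
      _ ≤ ‖z‖ * A := by nlinarith
  -- Since A ≥ 1, the root of A² + 2wA + ‖z‖² is at most A + u. The constant 3 covers 1/2 from u and
  -- 9/4 from u².
  set u := w + ‖z‖ ^ 2 / 2 with hu
  have h1 : √(1 + ‖s + z‖ ^ 2) ≤ A + u := by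
    have hpos : 0 ≤ A + u := by
      have := (abs_le.1 hwz).1
      rw [hu]; nlinarith
    rw [← Real.sqrt_sq hpos]
    apply Real.sqrt_le_sqrt
    rw [norm_add_sq_real]
    have h2 : (A + u) ^ 2 = A ^ 2 + 2 * (w * A) + A * ‖z‖ ^ 2 + u ^ 2 := by rw [hu]; ring
    rw [h2, hAsq, hwA]
    nlinarith [sq_nonneg u, sq_nonneg ‖z‖]
  have hu1 : |u| ≤ 3 / 2 * ‖z‖ := by
    have := abs_le.1 hwz
    rw [abs_le, hu]; constructor <;> nlinarith
  have h3 := Real.abs_exp_sub_one_sub_id_le (x := u) (by linarith)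
  have h4 : Real.exp u ≤ 1 + u + u ^ 2 := by linarith [(abs_le.1 h3).2]
  have h5 : u ^ 2 ≤ 9 / 4 * ‖z‖ ^ 2 := by
    have := sq_le_sq' (by linarith [(abs_le.1 hu1).1] : -(3 / 2 * ‖z‖) ≤ u) (abs_le.1 hu1).2
    nlinarith
  calc Real.exp (√(1 + ‖s + z‖ ^ 2)) ≤ Real.exp (A + u) := Real.exp_le_exp.2 h1
    _ = Real.exp A * Real.exp u := Real.exp_add _ _
    _ ≤ _ := by
      apply mul_le_mul_of_nonneg_left _ (Real.exp_pos _).le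
      have : u ≤ w + ‖z‖ ^ 2 / 2 := hu.le
      linarith [sq_nonneg ‖z‖]

variable [CompleteSpace H] [SecondCountableTopology H] [MeasurableSpace H] [BorelSpace H]

/-- The first-order term is the inner product of ξ with a function of S; independence and centering
make its expectation zero, and only the variance of ξ remains. -/
lemma integral_exp_sqrt_norm_add_le [IsProbabilityMeasure P] {S ξ : Ω → H} (hS : Measurable S)
    (hξ : Measurable ξ) (hind : IndepFun S ξ P) {B v : ℝ} (hSB : ∀ᵐ ω ∂P, ‖S ω‖ ≤ B)
    (hξB : ∀ᵐ ω ∂P, ‖ξ ω‖ ≤ 1 / 2) (hmean : ∫ ω, ξ ω ∂P = 0)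
    (hvar : ∫ ω, ‖ξ ω‖ ^ 2 ∂P ≤ v) :
    ∫ ω, Real.exp (√(1 + ‖S ω + ξ ω‖ ^ 2)) ∂P ≤
      (1 + 3 * v) * ∫ ω, Real.exp (√(1 + ‖S ω‖ ^ 2)) ∂P := by
  set g : H → ℝ := fun s => Real.exp (√(1 + ‖s‖ ^ 2)) with hg
  have hgm : Measurable g := by fun_prop
  have hpos : ∀ s : H, 0 < √(1 + ‖s‖ ^ 2) := fun s => Real.sqrt_pos.2 (by positivity)
  have hgB : ∀ s : H, ∀ C, ‖s‖ ≤ C → ‖g s‖ ≤ Real.exp (√(1 + C ^ 2)) := by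
    intro s C h
    rw [Real.norm_of_nonneg (Real.exp_pos _).le]
    have := norm_nonneg s
    exact Real.exp_le_exp.2 (Real.sqrt_le_sqrt (by nlinarith))
  have hgi : ∀ (T : Ω → H) (C : ℝ), Measurable T → (∀ᵐ ω ∂P, ‖T ω‖ ≤ C) →
      Integrable (fun ω => g (T ω)) P := fun T C hT hC =>
    Integrable.of_bound (hgm.comp hT).aestronglyMeasurable (Real.exp (√(1 + C ^ 2)))
      (hC.mono fun ω h => hgB _ _ h)
  have hSi := hgi S B hS hSB
  have hSξi := hgi (fun ω => S ω + ξ ω) (B + 1 / 2) (hS.add hξ) (by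
    filter_upwards [hSB, hξB] with ω h1 h2
    exact (norm_add_le _ _).trans (add_le_add h1 h2))
  set k : H → H := fun s => (g s / √(1 + ‖s‖ ^ 2)) • s with hk
  have hkm : Measurable k := by
    apply Measurable.smul _ measurable_id
    exact hgm.div (by fun_prop)
  have hki : Integrable (fun ω => k (S ω)) P := by
    refine Integrable.of_bound (hkm.comp hS).aestronglyMeasurable
      (Real.exp (√(1 + B ^ 2))) ?_
    filter_upwards [hSB] with ω h
    have h1 : ‖S ω‖ ≤ √(1 + ‖S ω‖ ^ 2) := Real.le_sqrt_of_sq_le (by linarith)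
    rw [hk]; simp only [norm_smul, norm_div]
    rw [Real.norm_of_nonneg (hpos (S ω)).le, div_mul_eq_mul_div, div_le_iff₀ (hpos _)]
    exact mul_le_mul (hgB _ _ h) h1 (norm_nonneg _) (Real.exp_pos _).le
  have hξi : Integrable ξ P := Integrable.of_bound hξ.aestronglyMeasurable _ hξB
  have hξ2i : Integrable (fun ω => ‖ξ ω‖ ^ 2) P := by
    refine Integrable.of_bound (by fun_prop) ((1 / 2) ^ 2) ?_
    filter_upwards [hξB] with ω h
    rw [Real.norm_of_nonneg (by positivity)]
    exact pow_le_pow_left₀ (norm_nonneg _) h 2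
  have hindk : IndepFun (fun ω => k (S ω)) ξ P := hind.comp hkm measurable_id
  have hcross : ∫ ω, inner ℝ (k (S ω)) (ξ ω) ∂P = 0 := by
    have := hindk.integral_bilin hki hξi (innerSL ℝ)
    rw [hmean, map_zero] at this
    exact this
  have hcrossi : Integrable (fun ω => inner ℝ (k (S ω)) (ξ ω)) P := by
    refine Integrable.mono (hki.norm) (by fun_prop) ?_
    filter_upwards [hξB] with ω h
    rw [norm_norm]
    refine (norm_inner_le_norm _ _).trans ?_
    nlinarith [norm_nonneg (k (S ω))]
  have hsqind : IndepFun (fun ω => g (S ω)) (fun ω => ‖ξ ω‖ ^ 2) P :=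
    hind.comp hgm (by fun_prop : Measurable fun z : H => ‖z‖ ^ 2)
  have hprodi : Integrable (fun ω => g (S ω) * ‖ξ ω‖ ^ 2) P := hsqind.integrable_mul hSi hξ2i
  have hprod : ∫ ω, g (S ω) * ‖ξ ω‖ ^ 2 ∂P = (∫ ω, g (S ω) ∂P) * ∫ ω, ‖ξ ω‖ ^ 2 ∂P :=
    hsqind.integral_mul_eq_mul_integral hSi.aestronglyMeasurable hξ2i.aestronglyMeasurable
  have hI0 : 0 ≤ ∫ ω, g (S ω) ∂P := integral_nonneg fun ω => (Real.exp_pos _).le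
  calc ∫ ω, g (S ω + ξ ω) ∂P
      ≤ ∫ ω, (g (S ω) + inner ℝ (k (S ω)) (ξ ω) + 3 * (g (S ω) * ‖ξ ω‖ ^ 2)) ∂P := by
        apply integral_mono_ae hSξi ((hSi.add hcrossi).add (hprodi.const_mul 3))
        filter_upwards [hξB] with ω h
        refine (exp_sqrt_norm_add_le (S ω) (ξ ω) h).trans_eq ?_
        simp only [Pi.add_apply, hk, hg, inner_smul_left, RCLike.conj_to_real]
        ring
    _ = (∫ ω, g (S ω) ∂P) + 0 + 3 * ((∫ ω, g (S ω) ∂P) * ∫ ω, ‖ξ ω‖ ^ 2 ∂P) := by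
        have h1 : ∫ ω, (g (S ω) + inner ℝ (k (S ω)) (ξ ω)) ∂P =
            (∫ ω, g (S ω) ∂P) + ∫ ω, inner ℝ (k (S ω)) (ξ ω) ∂P := integral_add hSi hcrossi
        have h2 : ∫ ω, (g (S ω) + inner ℝ (k (S ω)) (ξ ω) + 3 * (g (S ω) * ‖ξ ω‖ ^ 2)) ∂P =
            (∫ ω, (g (S ω) + inner ℝ (k (S ω)) (ξ ω)) ∂P) +
              ∫ ω, 3 * (g (S ω) * ‖ξ ω‖ ^ 2) ∂P :=
          integral_add (hSi.add hcrossi) (hprodi.const_mul 3)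
        rw [h2, h1, integral_const_mul, hprod, hcross]
    _ ≤ _ := by nlinarith [mul_le_mul_of_nonneg_left hvar hI0]

lemma integral_exp_sqrt_norm_sum_le [IsProbabilityMeasure P] {ξ : ℕ → Ω → H}
    (hξ : ∀ i, Measurable (ξ i)) (hind : iIndepFun ξ P) {v : ℝ} (hv : 0 ≤ v)
    (hξB : ∀ i, ∀ᵐ ω ∂P, ‖ξ i ω‖ ≤ 1 / 2) (hmean : ∀ i, ∫ ω, ξ i ω ∂P = 0)
    (hvar : ∀ i, ∫ ω, ‖ξ i ω‖ ^ 2 ∂P ≤ v) (n : ℕ) :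
    ∫ ω, Real.exp (√(1 + ‖∑ i ∈ Finset.range n, ξ i ω‖ ^ 2)) ∂P ≤
      (1 + 3 * v) ^ n * Real.exp 1 := by
  induction n with
  | zero => simp
  | succ n ih =>
    have hm : Measurable fun ω => ∑ i ∈ Finset.range n, ξ i ω :=
      Finset.measurable_fun_sum _ fun i _ => hξ i
    have hi : IndepFun (fun ω => ∑ i ∈ Finset.range n, ξ i ω) (ξ n) P := by
      have := hind.indepFun_finsetSum_of_notMem hξ (s := Finset.range n) (i := n) (by simp)
      convert this using 1
      ext ω; simp
    have hb : ∀ᵐ ω ∂P, ‖∑ i ∈ Finset.range n, ξ i ω‖ ≤ n * (1 / 2) := by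
      filter_upwards [ae_all_iff.2 hξB] with ω h
      refine (norm_sum_le _ _).trans ((Finset.sum_le_sum fun i _ => h i).trans ?_)
      simp
    simp only [Finset.sum_range_succ]
    refine (integral_exp_sqrt_norm_add_le hm (hξ n) hi hb (hξB n) (hmean n) (hvar n)).trans ?_
    rw [pow_succ]
    calc _ ≤ (1 + 3 * v) * ((1 + 3 * v) ^ n * Real.exp 1) :=
          mul_le_mul_of_nonneg_left ih (by positivity)
      _ = _ := by ring

/-- A Bernstein inequality for sums of independent centered vectors of a Hilbert space. -/
theorem measureReal_norm_sum_ge_le [IsProbabilityMeasure P] {ξ : ℕ → Ω → H}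
    (hξ : ∀ i, Measurable (ξ i)) (hind : iIndepFun ξ P) {t B v : ℝ} (ht : 0 ≤ t)
    (htB : t * B ≤ 1 / 2) (hv : 0 ≤ v)
    (hξB : ∀ i, ∀ᵐ ω ∂P, ‖ξ i ω‖ ≤ B) (hmean : ∀ i, ∫ ω, ξ i ω ∂P = 0)
    (hvar : ∀ i, ∫ ω, ‖ξ i ω‖ ^ 2 ∂P ≤ v) (n : ℕ) (r : ℝ) :
    P.real {ω | r ≤ ‖∑ i ∈ Finset.range n, ξ i ω‖} ≤
      Real.exp (1 + 3 * n * (t ^ 2 * v) - t * r) := by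
  have key := integral_exp_sqrt_norm_sum_le (P := P) (ξ := fun i ω => t • ξ i ω)
    (fun i => (hξ i).const_smul t)
    (hind.comp (fun _ x => t • x) fun _ => measurable_const_smul t)
    (v := t ^ 2 * v) (by positivity)
    (fun i => (hξB i).mono fun ω h => by
      rw [norm_smul, Real.norm_of_nonneg ht]
      exact (mul_le_mul_of_nonneg_left h ht).trans htB)
    (fun i => by rw [integral_smul, hmean, smul_zero])
    (fun i => by
      simp only [norm_smul, mul_pow, Real.norm_of_nonneg ht]
      rw [integral_const_mul]
      exact mul_le_mul_of_nonneg_left (hvar i) (by positivity)) n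
  have hm : Measurable fun ω => ∑ i ∈ Finset.range n, t • ξ i ω :=
    Finset.measurable_fun_sum _ fun i _ => (hξ i).const_smul t
  have hint : Integrable
      (fun ω => Real.exp (√(1 + ‖∑ i ∈ Finset.range n, t • ξ i ω‖ ^ 2))) P := by
    refine Integrable.of_bound (by fun_prop) (Real.exp (√(1 + (n * (1 / 2)) ^ 2))) ?_
    filter_upwards [ae_all_iff.2 hξB] with ω h
    rw [Real.norm_of_nonneg (Real.exp_pos _).le]
    refine Real.exp_le_exp.2 (Real.sqrt_le_sqrt (add_le_add le_rfl
      (pow_le_pow_left₀ (norm_nonneg _) ?_ 2)))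
    refine (norm_sum_le _ _).trans ((Finset.sum_le_sum (g := fun _ => 1 / 2) fun i _ => ?_).trans ?_)
    · rw [norm_smul, Real.norm_of_nonneg ht]
      exact (mul_le_mul_of_nonneg_left (h i) ht).trans htB
    · simp
  have hmarkov := mul_meas_ge_le_integral_of_nonneg (μ := P)
    (f := fun ω => Real.exp (√(1 + ‖∑ i ∈ Finset.range n, t • ξ i ω‖ ^ 2)))
    (ae_of_all _ fun ω => (Real.exp_pos _).le) hint (Real.exp (t * r))
  have hsub : P.real {ω | r ≤ ‖∑ i ∈ Finset.range n, ξ i ω‖} ≤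
      P.real {ω | Real.exp (t * r) ≤
        Real.exp (√(1 + ‖∑ i ∈ Finset.range n, t • ξ i ω‖ ^ 2))} := by
    refine measureReal_mono fun ω h => ?_
    have h : r ≤ ‖∑ i ∈ Finset.range n, ξ i ω‖ := h
    have h2 : t * r ≤ ‖∑ i ∈ Finset.range n, t • ξ i ω‖ := by
      rw [← Finset.smul_sum, norm_smul, Real.norm_of_nonneg ht]
      exact mul_le_mul_of_nonneg_left h ht
    exact Real.exp_le_exp.2 (h2.trans (Real.le_sqrt_of_sq_le (by linarith)))
  have hpow : (1 + 3 * (t ^ 2 * v)) ^ n ≤ Real.exp (3 * n * (t ^ 2 * v)) := by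
    have : 3 * n * (t ^ 2 * v) = n * (3 * (t ^ 2 * v)) := by ring
    rw [this, Real.exp_nat_mul]
    exact pow_le_pow_left₀ (by positivity)
      (by linarith [Real.add_one_le_exp (3 * (t ^ 2 * v))]) n
  have : Real.exp (t * r) * P.real {ω | r ≤ ‖∑ i ∈ Finset.range n, ξ i ω‖} ≤
      Real.exp (3 * n * (t ^ 2 * v)) * Real.exp 1 :=
    (mul_le_mul_of_nonneg_left hsub (Real.exp_pos _).le).trans (hmarkov.trans (key.trans
      (mul_le_mul_of_nonneg_right hpow (Real.exp_pos _).le)))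
  rw [← Real.exp_add] at this
  have e : Real.exp (1 + 3 * n * (t ^ 2 * v) - t * r) =
      Real.exp (3 * n * (t ^ 2 * v) + 1) / Real.exp (t * r) := by
    rw [← Real.exp_sub]; ring_nf
  rw [e, le_div_iff₀ (Real.exp_pos _)]
  linarith

end Bernstein

/-! ### Events of probability 1 − O(n⁻²) and concentration of i.i.d. sums -/

section HighProbability

variable {Ω : Type*} [MeasurableSpace Ω] {P : Measure Ω}

/-- The properties `p n` hold up to probabilities of order `n⁻²`. -/
def WithHighProb (P : Measure Ω) (p : ℕ → Ω → Prop) : Prop :=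
  ∃ C : ℝ, ∀ᶠ n : ℕ in atTop, P.real {ω | ¬ p n ω} ≤ C / (n : ℝ) ^ 2

namespace WithHighProb

variable {p q : ℕ → Ω → Prop}

lemma of_ae (h : ∀ᶠ n in atTop, ∀ᵐ ω ∂P, p n ω) : WithHighProb P p := by
  refine ⟨0, ?_⟩
  filter_upwards [h] with n hn
  rw [zero_div, measureReal_def, (ae_iff.1 hn : P {ω | ¬ p n ω} = 0), ENNReal.toReal_zero]

variable [IsProbabilityMeasure P]

lemma mono (hp : WithHighProb P p) (h : ∀ᶠ n in atTop, ∀ᵐ ω ∂P, p n ω → q n ω) :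
    WithHighProb P q := by
  obtain ⟨C, hC⟩ := hp
  refine ⟨C, ?_⟩
  filter_upwards [hC, h] with n hn hpq
  refine le_trans ?_ hn
  rw [measureReal_def, measureReal_def]
  refine ENNReal.toReal_mono (measure_ne_top _ _) (measure_mono_ae ?_)
  filter_upwards [hpq] with ω hω h1 h2
  exact h1 (hω h2)

lemma and (hp : WithHighProb P p) (hq : WithHighProb P q) :
    WithHighProb P fun n ω => p n ω ∧ q n ω := by
  obtain ⟨C, hC⟩ := hp
  obtain ⟨C', hC'⟩ := hq
  refine ⟨C + C', ?_⟩
  filter_upwards [hC, hC'] with n h1 h2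
  have : {ω | ¬ (p n ω ∧ q n ω)} ⊆ {ω | ¬ p n ω} ∪ {ω | ¬ q n ω} := by
    intro ω h
    by_cases hp : p n ω
    · exact Or.inr fun hq => h ⟨hp, hq⟩
    · exact Or.inl hp
  rw [add_div]
  exact (measureReal_mono this).trans ((measureReal_union_le _ _).trans (add_le_add h1 h2))

lemma forall_finset {ι : Type*} (s : Finset ι) {p : ι → ℕ → Ω → Prop}
    (h : ∀ i, WithHighProb P (p i)) : WithHighProb P fun n ω => ∀ i ∈ s, p i n ω := by
  classical
  induction s using Finset.induction_on with
  | empty => exact of_ae (by simp)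
  | insert a s _ ih =>
    refine ((h a).and ih).mono (Eventually.of_forall fun n => ae_of_all _ fun ω hω => ?_)
    simpa [Finset.forall_mem_insert] using hω

lemma forall_fintype {ι : Type*} [Fintype ι] {p : ι → ℕ → Ω → Prop}
    (h : ∀ i, WithHighProb P (p i)) : WithHighProb P fun n ω => ∀ i, p i n ω :=
  (forall_finset Finset.univ h).mono
    (Eventually.of_forall fun _ => ae_of_all _ fun _ hω i => hω i (Finset.mem_univ i))

/-- Borel–Cantelli, as n⁻² is summable; the shift by N discards the indices where the bound is not
yet valid. -/
lemma ae_eventually (hp : WithHighProb P p) : ∀ᵐ ω ∂P, ∀ᶠ n in atTop, p n ω := by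
  obtain ⟨C, hC⟩ := hp
  obtain ⟨N, hN⟩ := eventually_atTop.1 hC
  have hsum : Summable fun n : ℕ => P.real {ω | ¬ p (n + N) ω} := by
    refine Summable.of_nonneg_of_le (fun _ => measureReal_nonneg) (fun n => hN (n + N) (by omega)) ?_
    have : Summable fun n : ℕ => C / (n : ℝ) ^ 2 := by
      simpa [div_eq_mul_inv] using (Real.summable_nat_pow_inv.2 one_lt_two).mul_left C
    exact (summable_nat_add_iff N).2 this
  have h1 : (∑' n, P {ω | ¬ p (n + N) ω}) ≠ ⊤ := by
    have := hsum.tsum_ofReal_ne_top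
    simpa [measureReal_def, ENNReal.ofReal_toReal] using this
  filter_upwards [ae_eventually_notMem h1] with ω hω
  obtain ⟨k, hk⟩ := eventually_atTop.1 hω
  refine eventually_atTop.2 ⟨k + N, fun n hn => ?_⟩
  have := hk (n - N) (by omega)
  rw [Nat.sub_add_cancel (by omega)] at this
  simpa using this

end WithHighProb

variable {H : Type*} [NormedAddCommGroup H] [InnerProductSpace ℝ H] [CompleteSpace H]
  [SecondCountableTopology H] [MeasurableSpace H] [BorelSpace H]

/-- Here a is the scale of the deviation per term, b that of the variance, and s that of the
exponential parameter in Bernstein's inequality. The condition s b ≤ a keeps the variance term below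
the linear one, whose size n s a must beat log n. Covariances use b = 1 and s = a; kernel sums use a
= b = F_x(h) and s = 1. -/
theorem withHighProb_norm_sum_sub_le [IsProbabilityMeasure P] {E : Type*} [MeasurableSpace E]
    {W : ℕ → Ω → E} {W₀ : Ω → E} (hW : ∀ i, Measurable (W i))
    (hind : iIndepFun W P) (hident : ∀ i, IdentDistrib (W i) W₀ P P)
    {f : ℕ → E → H} (hf : ∀ n, Measurable (f n)) {B C : ℝ} (hC : 0 ≤ C)
    (hB : ∀ n, ∀ᵐ ω ∂P, ‖f n (W₀ ω)‖ ≤ B) {a b s : ℕ → ℝ} (hb : ∀ n, 0 ≤ b n)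
    (hvar : ∀ᶠ n in atTop, ∫ ω, ‖f n (W₀ ω)‖ ^ 2 ∂P ≤ C * b n)
    (hs0 : ∀ᶠ n in atTop, 0 ≤ s n) (hs1 : ∀ᶠ n in atTop, s n ≤ 1)
    (hsab : ∀ᶠ n in atTop, s n * b n ≤ a n)
    (hlim : Tendsto (fun n : ℕ => n * (s n * a n) / Real.log n) atTop atTop)
    {ε : ℝ} (hε : 0 < ε) :
    WithHighProb P fun n ω =>
      ‖∑ i ∈ Finset.range n, f n (W i ω) - (n : ℝ) • ∫ ω', f n (W₀ ω') ∂P‖ ≤ ε * (n * a n) := by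
  have hB0 : 0 ≤ B := by
    obtain ⟨ω, hω⟩ := (hB 0).exists
    exact (norm_nonneg _).trans hω
  have hW₀ : AEMeasurable W₀ P := (hident 0).aemeasurable_snd
  set τ : ℝ := min (1 / (4 * (B + 1))) (ε / (24 * (C + 1))) with hτ
  have hτ0 : 0 < τ := lt_min (by positivity) (by positivity)
  have hτB : τ * (2 * B) ≤ 1 / 2 := by
    have h1 : τ ≤ 1 / (4 * (B + 1)) := min_le_left _ _
    rw [le_div_iff₀ (by positivity)] at h1
    nlinarith
  have hτC : 12 * C * τ ≤ ε / 2 := by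
    have h1 : τ ≤ ε / (24 * (C + 1)) := min_le_right _ _
    rw [le_div_iff₀ (by positivity)] at h1
    nlinarith
  refine ⟨Real.exp 1, ?_⟩
  -- With this threshold the surviving half of the linear term is at least 2 log n, whence the bound
  -- e/n².
  filter_upwards [hvar, hs0, hs1, hsab, hlim.eventually_ge_atTop (4 / (τ * ε)),
    eventually_ge_atTop 2] with n hvar hs0 hs1 hsab hlim hn
  have hn0 : (0 : ℝ) < n := by positivity
  have hlog : 0 < Real.log n := Real.log_pos (by exact_mod_cast hn)
  rw [le_div_iff₀ hlog, div_mul_eq_mul_div, div_le_iff₀ (by positivity)] at hlim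
  set m := ∫ ω', f n (W₀ ω') ∂P with hm
  have hfi : AEStronglyMeasurable (fun ω => f n (W₀ ω)) P :=
    ((hf n).comp_aemeasurable hW₀).aestronglyMeasurable
  have hint : Integrable (fun ω => f n (W₀ ω)) P := Integrable.of_bound hfi B (hB n)
  have hint2 : Integrable (fun ω => ‖f n (W₀ ω)‖ ^ 2) P := by
    refine Integrable.of_bound (hfi.norm.pow 2) (B ^ 2) ?_
    filter_upwards [hB n] with ω h
    rw [Real.norm_of_nonneg (by positivity)]
    exact pow_le_pow_left₀ (norm_nonneg _) h 2
  have hmB : ‖m‖ ≤ B := by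
    simpa using norm_integral_le_of_norm_le_const (hB n)
  have hm2 : ‖m‖ ^ 2 ≤ C * b n := by
    refine le_trans ?_ hvar
    have h1 : 0 ≤ ∫ ω, (‖f n (W₀ ω)‖ - ‖m‖) ^ 2 ∂P := integral_nonneg fun _ => sq_nonneg _
    have h2 : ‖m‖ ≤ ∫ ω, ‖f n (W₀ ω)‖ ∂P := norm_integral_le_integral_norm _
    have h3 : ∫ ω, (‖f n (W₀ ω)‖ - ‖m‖) ^ 2 ∂P =
        (∫ ω, ‖f n (W₀ ω)‖ ^ 2 ∂P) - 2 * ‖m‖ * (∫ ω, ‖f n (W₀ ω)‖ ∂P) + ‖m‖ ^ 2 := by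
      have : ∀ ω, (‖f n (W₀ ω)‖ - ‖m‖) ^ 2 =
          ‖f n (W₀ ω)‖ ^ 2 - 2 * ‖m‖ * ‖f n (W₀ ω)‖ + ‖m‖ ^ 2 := fun ω => by ring
      simp_rw [this]
      have e1 : ∫ ω, (‖f n (W₀ ω)‖ ^ 2 - 2 * ‖m‖ * ‖f n (W₀ ω)‖) ∂P =
          (∫ ω, ‖f n (W₀ ω)‖ ^ 2 ∂P) - ∫ ω, 2 * ‖m‖ * ‖f n (W₀ ω)‖ ∂P :=
        integral_sub hint2 (hint.norm.const_mul _)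
      have e2 : ∫ ω, (‖f n (W₀ ω)‖ ^ 2 - 2 * ‖m‖ * ‖f n (W₀ ω)‖ + ‖m‖ ^ 2) ∂P =
          (∫ ω, (‖f n (W₀ ω)‖ ^ 2 - 2 * ‖m‖ * ‖f n (W₀ ω)‖) ∂P) + ∫ _, ‖m‖ ^ 2 ∂P :=
        integral_add (hint2.sub (hint.norm.const_mul _)) (integrable_const _)
      rw [e2, e1, integral_const_mul]
      simp
    nlinarith [norm_nonneg m]
  have hid : ∀ i, IdentDistrib (fun ω => f n (W i ω) - m) (fun ω => f n (W₀ ω) - m) P P :=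
    fun i => (hident i).comp ((hf n).sub_const m)
  have key := measureReal_norm_sum_ge_le (P := P) (ξ := fun i ω => f n (W i ω) - m)
    (fun i => ((hf n).comp (hW i)).sub_const m)
    (hind.comp (fun _ x => f n x - m) fun _ => (hf n).sub_const m)
    (t := τ * s n) (B := 2 * B) (v := 4 * (C * b n)) (by positivity)
    (by nlinarith [mul_nonneg hτ0.le hB0, mul_le_mul_of_nonneg_left hs1 (mul_nonneg hτ0.le hB0)])
    (by have := hb n; positivity)
    (fun i => by
      refine (hid i).symm.ae_snd (p := fun x => ‖x‖ ≤ 2 * B)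
        (measurableSet_le measurable_norm measurable_const) ?_
      filter_upwards [hB n] with ω h
      exact (norm_sub_le _ _).trans (by linarith))
    (fun i => by
      rw [(hid i).integral_eq, integral_sub hint (integrable_const _)]
      simp [hm])
    (fun i => by
      have e1 : ∫ ω, ‖f n (W i ω) - m‖ ^ 2 ∂P = ∫ ω, ‖f n (W₀ ω) - m‖ ^ 2 ∂P :=
        ((hid i).comp (measurable_norm.pow_const 2)).integral_eq
      rw [e1]
      calc ∫ ω, ‖f n (W₀ ω) - m‖ ^ 2 ∂P ≤ ∫ ω, (2 * ‖f n (W₀ ω)‖ ^ 2 + 2 * ‖m‖ ^ 2) ∂P := by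
            refine integral_mono_of_nonneg (ae_of_all _ fun _ => by positivity)
              ((hint2.const_mul 2).add (integrable_const _)) (ae_of_all _ fun ω => ?_)
            have := norm_sub_le (f n (W₀ ω)) m
            have h0 := norm_nonneg (f n (W₀ ω) - m)
            show ‖f n (W₀ ω) - m‖ ^ 2 ≤ 2 * ‖f n (W₀ ω)‖ ^ 2 + 2 * ‖m‖ ^ 2
            nlinarith [sq_nonneg (‖f n (W₀ ω)‖ - ‖m‖)]
        _ = 2 * (∫ ω, ‖f n (W₀ ω)‖ ^ 2 ∂P) + 2 * ‖m‖ ^ 2 := by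
            rw [integral_add (hint2.const_mul 2) (integrable_const _), integral_const_mul]
            simp
        _ ≤ _ := by linarith)
    n (ε * (n * a n))
  have hsum : ∀ ω, ∑ i ∈ Finset.range n, (f n (W i ω) - m) =
      ∑ i ∈ Finset.range n, f n (W i ω) - (n : ℝ) • m := by
    intro ω
    simp [Finset.sum_sub_distrib, Nat.cast_smul_eq_nsmul]
  simp_rw [hsum] at key
  refine (measureReal_mono fun ω h => (not_le.1 h).le).trans (key.trans ?_)
  have hexp : 1 + 3 * n * ((τ * s n) ^ 2 * (4 * (C * b n))) - τ * s n * (ε * (n * a n)) ≤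
      1 - 2 * Real.log n := by
    have h1 : (τ * s n) ^ 2 * (C * b n) ≤ τ ^ 2 * C * (s n * a n) := by
      have : τ ^ 2 * C * s n * (s n * b n) ≤ τ ^ 2 * C * s n * a n :=
        mul_le_mul_of_nonneg_left hsab (by positivity)
      linarith
    have h2 : 3 * n * ((τ * s n) ^ 2 * (4 * (C * b n))) ≤ 12 * n * (τ ^ 2 * C * (s n * a n)) := by
      nlinarith
    have hsa : 0 ≤ n * (s n * a n) := by
      by_contra! hneg
      nlinarith [mul_pos hτ0 hε]
    have h3 : 12 * C * τ * (τ * (n * (s n * a n))) ≤ ε / 2 * (τ * (n * (s n * a n))) :=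
      mul_le_mul_of_nonneg_right hτC (by positivity)
    nlinarith
  refine (Real.exp_le_exp.2 hexp).trans_eq ?_
  rw [Real.exp_sub, two_mul, Real.exp_add, Real.exp_log hn0, sq]

end HighProbability

/-! ### Variational characterization of eigenvalues -/

section Operators

variable {F : Type*} [NormedAddCommGroup F] [InnerProductSpace ℝ F]

lemma mem_span_range_orthogonal_iff {ι : Type*} {e : ι → F} {u : F} :
    u ∈ (Submodule.span ℝ (Set.range e))ᗮ ↔ ∀ j, (inner ℝ (e j) u : ℝ) = 0 := by
  rw [Submodule.mem_orthogonal]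
  refine ⟨fun h j => h _ (Submodule.subset_span ⟨j, rfl⟩), fun h w hw => ?_⟩
  induction hw using Submodule.span_induction with
  | mem x hx => obtain ⟨j, rfl⟩ := hx; exact h j
  | zero => simp
  | add x y _ _ hx hy => rw [inner_add_left, hx, hy, add_zero]
  | smul a x _ hx => rw [inner_smul_left, hx, mul_zero]

lemma projector_apply {D : ℕ} {e : Fin D → F} (he : Orthonormal ℝ e) (z : F) :
    projector e z = ∑ i, (inner ℝ (e i) z : ℝ) • e i := by
  have := FiniteDimensional.span_of_finite ℝ (Set.finite_range e)
  refine Submodule.eq_starProjection_of_mem_orthogonal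
    (Submodule.sum_mem _ fun i _ => Submodule.smul_mem _ _ (Submodule.subset_span ⟨i, rfl⟩)) ?_
  rw [mem_span_range_orthogonal_iff]
  intro j
  rw [inner_sub_right, inner_sum]
  simp [inner_smul_right, orthonormal_iff_ite.1 he]

lemma norm_projector_le {D : ℕ} (e : Fin D → F) (z : F) : ‖projector e z‖ ≤ ‖z‖ := by
  have := FiniteDimensional.span_of_finite ℝ (Set.finite_range e)
  exact Submodule.norm_starProjection_apply_le _ z

lemma projector_projector {D : ℕ} (e : Fin D → F) (z : F) :
    projector e (projector e z) = projector e z := by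
  have := FiniteDimensional.span_of_finite ℝ (Set.finite_range e)
  exact Submodule.starProjection_eq_self_iff.2 (Submodule.starProjection_apply_mem _ z)

lemma inner_projector_sub_self {D : ℕ} {e : Fin D → F} (he : Orthonormal ℝ e) (z : F) (j : Fin D) :
    (inner ℝ (e j) (z - projector e z) : ℝ) = 0 := by
  rw [projector_apply he, inner_sub_right, inner_sum]
  simp [inner_smul_right, orthonormal_iff_ite.1 he]

variable [CompleteSpace F]

/-- On the orthogonal complement of a family of eigenvectors, the quadratic form of a positive
compact operator attains its supremum over the unit sphere at an eigenvector. -/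
theorem exists_eigenvector_orthogonal {T : F →L[ℝ] F}
    (hsymm : ∀ u v, (inner ℝ (T u) v : ℝ) = inner ℝ u (T v))
    (hpos : ∀ u, 0 ≤ (inner ℝ (T u) u : ℝ)) (hcpt : IsCompactOperator T) {ι : Type*} {e : ι → F}
    {lam : ι → ℝ} (he : ∀ i, T (e i) = lam i • e i)
    (hne : ∃ u, u ≠ 0 ∧ ∀ j, (inner ℝ (e j) u : ℝ) = 0) :
    ∃ (R : ℝ) (v : F), v ≠ 0 ∧ (∀ j, (inner ℝ (e j) v : ℝ) = 0) ∧ T v = R • v ∧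
      ∀ u, (∀ j, (inner ℝ (e j) u : ℝ) = 0) → (inner ℝ (T u) u : ℝ) ≤ R * ‖u‖ ^ 2 := by
  set V := (Submodule.span ℝ (Set.range e))ᗮ with hV
  have hTV : ∀ x ∈ V, T x ∈ V := by
    intro x hx
    rw [hV, mem_span_range_orthogonal_iff] at hx ⊢
    intro j
    rw [← hsymm, he, inner_smul_left, hx, mul_zero]
  let S : V →L[ℝ] V := T.restrict hTV
  have hScpt : IsCompactOperator S := hcpt.restrict' hTV
  have hSapp : ∀ x : V, ((S x : V) : F) = T x := fun x => rfl
  have hSsymm : S.IsSymmetric := fun x y => by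
    simpa [Submodule.coe_inner, hSapp] using hsymm x y
  obtain ⟨u₀, hu₀, hu₀V⟩ := hne
  have hu₀mem : u₀ ∈ V := by rw [hV, mem_span_range_orthogonal_iff]; exact hu₀V
  have : Nontrivial V := ⟨⟨⟨u₀, hu₀mem⟩, 0, fun h => hu₀ (by simpa using congrArg Subtype.val h)⟩⟩
  have hbound : ∀ u, (∀ j, (inner ℝ (e j) u : ℝ) = 0) →
      (inner ℝ (T u) u : ℝ) ≤ ‖S‖ * ‖u‖ ^ 2 := by
    intro u hu
    have hu : u ∈ V := by rw [hV, mem_span_range_orthogonal_iff]; exact hu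
    have h1 : ‖T u‖ ≤ ‖S‖ * ‖u‖ := S.le_opNorm ⟨u, hu⟩
    refine (real_inner_le_norm _ _).trans ?_
    nlinarith [norm_nonneg u]
  -- The Fredholm alternative below needs a nonzero value; if S vanishes, any admissible vector is
  -- an eigenvector for 0.
  by_cases hS0 : S = 0
  · refine ⟨‖S‖, u₀, hu₀, hu₀V, ?_, hbound⟩
    have : T u₀ = 0 := by
      have := hSapp ⟨u₀, hu₀mem⟩
      rw [hS0] at this
      simpa using this.symm
    have hn : ‖S‖ = 0 := by rw [hS0]; exact ContinuousLinearMap.opNorm_zero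
    rw [this, hn, zero_smul]
  have hSn : ‖S‖ ≠ 0 := fun h => hS0 ((ContinuousLinearMap.opNorm_zero_iff S).1 h)
  -- Otherwise ‖S‖ would lie in the resolvent set, keeping all Rayleigh quotients below ‖S‖ − ε; but
  -- S is symmetric and positive, so their supremum is ‖S‖.
  have hev : Module.End.HasEigenvalue (S : Module.End ℝ V) ‖S‖ := by
    refine (IsCompactOperator.hasEigenvalue_or_mem_resolventSet hScpt hSn).resolve_right fun h => ?_
    obtain ⟨ε, hε, hle⟩ := S.rayleighQuotient_le_of_norm_mem_resolventSet h
    have h1 := S.norm_eq_iSup_rayleighQuotient hSsymm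
    have h2 : ⨆ x, |S.rayleighQuotient x| ≤ ‖S‖ - ε := by
      refine ciSup_le fun x => ?_
      rw [abs_of_nonneg]
      · exact hle x
      · rw [ContinuousLinearMap.rayleighQuotient]
        refine div_nonneg ?_ (by positivity)
        simpa [ContinuousLinearMap.reApplyInnerSelf, Submodule.coe_inner, hSapp] using hpos x
    linarith
  obtain ⟨v, hv⟩ := hev.exists_hasEigenvector
  refine ⟨‖S‖, v, fun h => hv.2 (by simpa using h), mem_span_range_orthogonal_iff.1 v.2, ?_, hbound⟩
  have := hv.apply_eq_smul
  simpa [hSapp] using congrArg Subtype.val this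

lemma IsLeadingEigensystem.inner_apply_self_le {D : ℕ} {T : F →L[ℝ] F}
    (hsymm : ∀ u v, (inner ℝ (T u) v : ℝ) = inner ℝ u (T v))
    (hpos : ∀ u, 0 ≤ (inner ℝ (T u) u : ℝ)) (hcpt : IsCompactOperator T)
    {e : Fin D → F} {lam : Fin D → ℝ} (he : IsLeadingEigensystem T e lam) (i : Fin D) {u : F}
    (hu : ∀ j, (inner ℝ (e j) u : ℝ) = 0) : (inner ℝ (T u) u : ℝ) ≤ lam i * ‖u‖ ^ 2 := by
  by_cases h0 : u = 0
  · simp [h0]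
  obtain ⟨R, v, hv, hve, hTv, hR⟩ :=
    exists_eigenvector_orthogonal hsymm hpos hcpt he.eigen ⟨u, h0, hu⟩
  exact (hR u hu).trans
    (mul_le_mul_of_nonneg_right (he.maximal v R hv hve hTv i) (by positivity))

/-- The supremum of the form on the complement is attained at an eigenvector, so strict separation
of eigenvalues leaves a positive gap. If the complement is zero (dimension D), any R below all `lam
i` will do. -/
lemma exists_gap_of_hasSeparatedEigenvalues {D : ℕ} {T : F →L[ℝ] F}
    (hsymm : ∀ u v, (inner ℝ (T u) v : ℝ) = inner ℝ u (T v))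
    (hpos : ∀ u, 0 ≤ (inner ℝ (T u) u : ℝ)) (hcpt : IsCompactOperator T)
    {e : Fin D → F} {lam : Fin D → ℝ} (he : ∀ i, T (e i) = lam i • e i)
    (hsep : HasSeparatedEigenvalues T e lam) :
    ∃ R δ : ℝ, 0 < δ ∧ (∀ i, R + δ ≤ lam i) ∧
      ∀ u, (∀ j, (inner ℝ (e j) u : ℝ) = 0) → (inner ℝ (T u) u : ℝ) ≤ R * ‖u‖ ^ 2 := by
  suffices h : ∃ R : ℝ, (∀ i, R < lam i) ∧
      ∀ u, (∀ j, (inner ℝ (e j) u : ℝ) = 0) → (inner ℝ (T u) u : ℝ) ≤ R * ‖u‖ ^ 2 by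
    obtain ⟨R, hR, hu⟩ := h
    have : ∀ᶠ δ in 𝓝[>] (0 : ℝ), ∀ i, R + δ ≤ lam i := by
      rw [eventually_all]
      intro i
      filter_upwards [Ioo_mem_nhdsGT (sub_pos.2 (hR i))] with δ hδ
      linarith [hδ.2]
    obtain ⟨δ, h1, h2⟩ := (this.and self_mem_nhdsWithin).exists
    exact ⟨R, δ, h2, h1, hu⟩
  by_cases hne : ∃ u, u ≠ 0 ∧ ∀ j, (inner ℝ (e j) u : ℝ) = 0
  · obtain ⟨R, v, hv, hve, hTv, hR⟩ := exists_eigenvector_orthogonal hsymm hpos hcpt he hne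
    exact ⟨R, hsep.2 v R hv hve hTv, hR⟩
  · push Not at hne
    obtain ⟨R, hR⟩ := (Set.finite_range lam).bddBelow
    refine ⟨R - 1, fun i => by linarith [hR ⟨i, rfl⟩], fun u hu => ?_⟩
    have : u = 0 := by
      by_contra h
      obtain ⟨j, hj⟩ := hne u h
      exact hj (hu j)
    simp [this]

omit [CompleteSpace F] in
/-- A min-max comparison: an upper bound of a quadratic form on a subspace of codimension `D` is
an upper bound on the orthogonal complement of its `D` leading eigenvectors. -/
theorem inner_apply_self_le_of_orthogonal {D : ℕ} {G : F →L[ℝ] F}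
    (hsymm : ∀ u v, (inner ℝ (G u) v : ℝ) = inner ℝ u (G v)) {e f : Fin D → F} {μ : Fin D → ℝ}
    (hf : Orthonormal ℝ f) (hGf : ∀ i, G (f i) = μ i • f i)
    (hlead : ∀ i, ∀ u, (∀ j, (inner ℝ (f j) u : ℝ) = 0) → (inner ℝ (G u) u : ℝ) ≤ μ i * ‖u‖ ^ 2)
    {R : ℝ} (hR : ∀ u, (∀ j, (inner ℝ (e j) u : ℝ) = 0) → (inner ℝ (G u) u : ℝ) ≤ R * ‖u‖ ^ 2)
    {w : F} (hw : ∀ j, (inner ℝ (f j) w : ℝ) = 0) : (inner ℝ (G w) w : ℝ) ≤ R * ‖w‖ ^ 2 := by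
  by_cases hw0 : w = 0
  · simp [hw0]
  have hwn : 0 < ‖w‖ ^ 2 := by positivity
  set comb : ((Fin D → ℝ) × ℝ) →ₗ[ℝ] F :=
    (Fintype.linearCombination ℝ f).coprod (LinearMap.toSpanSingleton ℝ F w) with hcomb
  have hcombapp : ∀ c a, comb (c, a) = ∑ i, c i • f i + a • w := by
    intro c a
    simp [hcomb, Fintype.linearCombination_apply]
  set L : ((Fin D → ℝ) × ℝ) →ₗ[ℝ] (Fin D → ℝ) :=
    (LinearMap.pi fun j => (innerₛₗ ℝ (e j))) ∘ₗ comb with hL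
  -- Dimension count: D + 1 coefficients against D orthogonality conditions produce a nonzero vector
  -- of the span of w and the f_i orthogonal to every e_j.
  have hker : L.ker ≠ ⊥ := L.ker_ne_bot_of_finrank_lt (by simp)
  obtain ⟨⟨c, a⟩, hmem, hne⟩ := L.ker.ne_bot_iff.1 hker
  set x := ∑ i, c i • f i with hx
  have hxw : (inner ℝ x w : ℝ) = 0 := by
    rw [hx, sum_inner]; simp [inner_smul_left, hw]
  have hGx : G x = ∑ i, (c i * μ i) • f i := by
    simp [hx, map_sum, hGf, smul_smul]
  have hGxw : (inner ℝ (G x) w : ℝ) = 0 := by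
    rw [hGx, sum_inner]; simp [inner_smul_left, hw]
  have hGwx : (inner ℝ (G w) x : ℝ) = 0 := by
    rw [hsymm, real_inner_comm]; exact hGxw
  have hxx : (inner ℝ x x : ℝ) = ∑ i, c i * c i := by
    rw [hx, hf.inner_sum]; simp
  have hGxx : (inner ℝ (G x) x : ℝ) = ∑ i, c i * μ i * c i := by
    rw [hGx, hx, hf.inner_sum]; simp
  have hu := hR (comb (c, a)) fun j => by
    have := congrFun (LinearMap.mem_ker.1 hmem) j
    simpa [hL] using this
  have hquad : (inner ℝ (G (x + a • w)) (x + a • w) : ℝ) =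
      ∑ i, c i * μ i * c i + a * a * inner ℝ (G w) w := by
    simp only [map_add, map_smul, inner_add_left, inner_add_right, inner_smul_left,
      inner_smul_right, hGxw, hGwx, hGxx, RCLike.conj_to_real]
    ring
  have hnorm : ‖x + a • w‖ ^ 2 = ∑ i, c i * c i + a * a * ‖w‖ ^ 2 := by
    rw [← real_inner_self_eq_norm_sq, ← real_inner_self_eq_norm_sq]
    simp only [inner_add_left, inner_add_right, inner_smul_left, inner_smul_right, hxw,
      real_inner_comm w x ▸ hxw, hxx, RCLike.conj_to_real]
    ring
  rw [hcombapp, hquad, hnorm] at hu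
  -- The Rayleigh quotient of w is at most every μ i, so the form is at least q‖·‖² on the whole
  -- span. At the vector just found it is at most R‖·‖², hence q ≤ R.
  set q := (inner ℝ (G w) w : ℝ) / ‖w‖ ^ 2 with hq
  have hqw : (inner ℝ (G w) w : ℝ) = q * ‖w‖ ^ 2 := by rw [hq]; field_simp
  have hqμ : ∀ i, q ≤ μ i := fun i => by
    rw [hq, div_le_iff₀ hwn]; exact hlead i w hw
  have hsum : q * ∑ i, c i * c i ≤ ∑ i, c i * μ i * c i := by
    rw [Finset.mul_sum]
    refine Finset.sum_le_sum fun i _ => ?_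
    nlinarith [mul_self_nonneg (c i), hqμ i]
  have hpos : 0 < ∑ i, c i * c i + a * a * ‖w‖ ^ 2 := by
    have h1 : 0 ≤ ∑ i, c i * c i := Finset.sum_nonneg fun i _ => mul_self_nonneg _
    have h2 : 0 ≤ a * a * ‖w‖ ^ 2 := mul_nonneg (mul_self_nonneg a) hwn.le
    refine lt_of_le_of_ne (by linarith) fun h => hne ?_
    have h3 : ∑ i, c i * c i = 0 := by linarith
    have h4 : a * a * ‖w‖ ^ 2 = 0 := by linarith
    have h5 : a = 0 := by
      rcases mul_eq_zero.1 h4 with h | h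
      · exact mul_self_eq_zero.1 h
      · exact absurd h hwn.ne'
    have h6 : c = 0 := by
      ext i
      exact mul_self_eq_zero.1
        ((Finset.sum_eq_zero_iff_of_nonneg fun i _ => mul_self_nonneg (c i)).1 h3 i
          (Finset.mem_univ i))
    rw [h5, h6]; rfl
  have hqR : q ≤ R := by
    rw [hqw] at hu
    by_contra! hlt
    nlinarith [mul_lt_mul_of_pos_right hlt hpos]
  rw [hqw]
  exact mul_le_mul_of_nonneg_right hqR hwn.le

end Operators

/-! ### Perturbation of spectral projectors -/

section Perturbation

variable {F : Type*} [NormedAddCommGroup F] [InnerProductSpace ℝ F]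

lemma norm_sub_projector_sq {D : ℕ} {f : Fin D → F} (hf : Orthonormal ℝ f) (x : F) :
    ‖x - projector f x‖ ^ 2 = ‖x‖ ^ 2 - ∑ i, (inner ℝ (f i) x : ℝ) ^ 2 := by
  have h : (inner ℝ (projector f x) (x - projector f x) : ℝ) = 0 := by
    nth_rw 1 [projector_apply hf]
    rw [sum_inner]
    simp [inner_smul_left, inner_projector_sub_self hf]
  have h2 : ‖x - projector f x‖ ^ 2 = inner ℝ x x - inner ℝ x (projector f x) := by
    rw [← real_inner_self_eq_norm_sq, inner_sub_left, h, sub_zero, inner_sub_right]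
  rw [h2, real_inner_self_eq_norm_sq, projector_apply hf, inner_sum]
  congr 1
  refine Finset.sum_congr rfl fun i _ => ?_
  rw [inner_smul_right, real_inner_comm x, sq]

/-- Both sides equal D minus the sum of all ⟨e_j, f_i⟩², which is symmetric. This uses that the two
families have the same size. -/
lemma sum_norm_sub_projector_sq_comm {D : ℕ} {e f : Fin D → F} (he : Orthonormal ℝ e)
    (hf : Orthonormal ℝ f) :
    ∑ i, ‖f i - projector e (f i)‖ ^ 2 = ∑ j, ‖e j - projector f (e j)‖ ^ 2 := by
  simp_rw [norm_sub_projector_sq he, norm_sub_projector_sq hf, he.norm_eq_one, hf.norm_eq_one,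
    Finset.sum_sub_distrib]
  rw [Finset.sum_comm]
  simp_rw [real_inner_comm]

/-- The difference has two parts: the defect of the e_j under the projector on f, and that of the
f_i under the projector on e. The symmetry of the sums of squares bounds the latter by the former,
so only the e_j need be controlled. -/
lemma norm_projector_sub_projector_le {D : ℕ} {e f : Fin D → F} (he : Orthonormal ℝ e)
    (hf : Orthonormal ℝ f) (z : F) :
    ‖projector f z - projector e z‖ ≤
      (1 + D) * (∑ j, ‖e j - projector f (e j)‖) * ‖z‖ := by
  set S := ∑ j, ‖e j - projector f (e j)‖ with hS
  have hS0 : 0 ≤ S := Finset.sum_nonneg fun _ _ => norm_nonneg _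
  have hsplit : projector f z - projector e z =
      projector f (z - projector e z) - (projector e z - projector f (projector e z)) := by
    rw [map_sub]; abel
  have h1 : ‖projector e z - projector f (projector e z)‖ ≤ S * ‖z‖ := by
    have : projector e z - projector f (projector e z) =
        ∑ j, (inner ℝ (e j) z : ℝ) • (e j - projector f (e j)) := by
      rw [projector_apply he z, map_sum, ← Finset.sum_sub_distrib]
      simp [smul_sub]
    rw [this, hS, Finset.sum_mul]
    refine (norm_sum_le _ _).trans (Finset.sum_le_sum fun j _ => ?_)
    rw [norm_smul, mul_comm]
    refine mul_le_mul_of_nonneg_left ?_ (norm_nonneg _)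
    simpa [he.norm_eq_one] using norm_inner_le_norm (𝕜 := ℝ) (e j) z
  have h2 : ∀ i, ‖f i - projector e (f i)‖ ≤ S := by
    intro i
    refine abs_le_of_sq_le_sq' ?_ hS0 |>.2
    calc ‖f i - projector e (f i)‖ ^ 2 ≤ ∑ i, ‖f i - projector e (f i)‖ ^ 2 :=
          Finset.single_le_sum (f := fun i => ‖f i - projector e (f i)‖ ^ 2)
            (fun _ _ => by positivity) (Finset.mem_univ i)
      _ = ∑ j, ‖e j - projector f (e j)‖ ^ 2 := sum_norm_sub_projector_sq_comm he hf
      _ ≤ S ^ 2 := Finset.sum_sq_le_sq_sum_of_nonneg fun _ _ => norm_nonneg _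
  have h3 : ‖projector f (z - projector e z)‖ ≤ D * S * ‖z‖ := by
    rw [projector_apply hf]
    refine (norm_sum_le _ _).trans ?_
    calc ∑ i, ‖(inner ℝ (f i) (z - projector e z) : ℝ) • f i‖ ≤ ∑ _i : Fin D, S * ‖z‖ := by
          refine Finset.sum_le_sum fun i _ => ?_
          rw [norm_smul, hf.norm_eq_one, mul_one]
          have : (inner ℝ (f i) (z - projector e z) : ℝ) = inner ℝ (f i - projector e (f i)) z := by
            rw [inner_sub_right, inner_sub_left, projector_apply he, projector_apply he, inner_sum,
              sum_inner]
            congr 1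
            refine Finset.sum_congr rfl fun k _ => ?_
            rw [inner_smul_right, inner_smul_left, RCLike.conj_to_real, real_inner_comm (e k) (f i)]
            ring
          rw [this]
          exact (norm_inner_le_norm _ _).trans (mul_le_mul_of_nonneg_right (h2 i) (norm_nonneg _))
      _ = D * S * ‖z‖ := by simp [mul_assoc]
  rw [hsplit]
  refine (norm_sub_le _ _).trans ?_
  linarith

/-- A Davis–Kahan bound for spectral projectors. -/
theorem norm_projector_sub_projector_le_of_gap {D : ℕ} {G : F →L[ℝ] F}
    (hsymm : ∀ u v, (inner ℝ (G u) v : ℝ) = inner ℝ u (G v)) {e f : Fin D → F} {lam μ : Fin D → ℝ}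
    (he : Orthonormal ℝ e) (hf : Orthonormal ℝ f) (hGf : ∀ i, G (f i) = μ i • f i)
    (hlead : ∀ i, ∀ u, (∀ j, (inner ℝ (f j) u : ℝ) = 0) → (inner ℝ (G u) u : ℝ) ≤ μ i * ‖u‖ ^ 2)
    {R δ : ℝ} (hδ : 0 < δ) (hgap : ∀ j, R + δ ≤ lam j)
    (hR : ∀ u, (∀ j, (inner ℝ (e j) u : ℝ) = 0) → (inner ℝ (G u) u : ℝ) ≤ R * ‖u‖ ^ 2) (z : F) :
    ‖projector f z - projector e z‖ ≤
      (1 + D) / δ * (∑ j, ‖G (e j) - lam j • e j‖) * ‖z‖ := by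
  have key : ∀ j, ‖e j - projector f (e j)‖ ≤ ‖G (e j) - lam j • e j‖ / δ := by
    intro j
    set w := e j - projector f (e j) with hw
    have hwf : ∀ i, (inner ℝ (f i) w : ℝ) = 0 := inner_projector_sub_self hf (e j)
    have hpw : (inner ℝ (projector f (e j)) w : ℝ) = 0 := by
      rw [projector_apply hf, sum_inner]; simp [inner_smul_left, hwf]
    have hGpw : (inner ℝ (G (projector f (e j))) w : ℝ) = 0 := by
      rw [projector_apply hf, map_sum, sum_inner]
      simp [hGf, inner_smul_left, hwf]
    have hew : (inner ℝ (e j) w : ℝ) = ‖w‖ ^ 2 := by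
      rw [← real_inner_self_eq_norm_sq]
      nth_rw 2 [hw]
      rw [inner_sub_left, hpw, sub_zero]
    have hGw := inner_apply_self_le_of_orthogonal hsymm hf hGf hlead hR hwf
    -- The span of the f_i is invariant under G and orthogonal to w, so only e_j contributes. As the
    -- form at w is also at most R‖w‖², the gap gives δ‖w‖² ≤ (residual norm)·‖w‖.
    have h1 : (inner ℝ (G w) w : ℝ) = lam j * ‖w‖ ^ 2 + inner ℝ (G (e j) - lam j • e j) w := by
      nth_rw 1 [hw]
      rw [map_sub, inner_sub_left, hGpw, inner_sub_left, inner_smul_left, hew]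
      simp
    have h2 : -(‖G (e j) - lam j • e j‖ * ‖w‖) ≤ (inner ℝ (G (e j) - lam j • e j) w : ℝ) :=
      neg_le_of_abs_le (abs_real_inner_le_norm _ _)
    have h3 := hgap j
    rw [le_div_iff₀ hδ]
    by_cases hw0 : ‖w‖ = 0
    · rw [hw0, zero_mul]; positivity
    have hwpos : 0 < ‖w‖ := lt_of_le_of_ne (norm_nonneg _) (Ne.symm hw0)
    have h4 : δ * ‖w‖ ^ 2 ≤ ‖G (e j) - lam j • e j‖ * ‖w‖ := by nlinarith [sq_nonneg ‖w‖]
    nlinarith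
  refine (norm_projector_sub_projector_le he hf z).trans ?_
  refine mul_le_mul_of_nonneg_right ?_ (norm_nonneg _)
  rw [div_mul_eq_mul_div, mul_div_assoc, Finset.sum_div]
  exact mul_le_mul_of_nonneg_left (Finset.sum_le_sum fun j _ => key j) (by positivity)

end Perturbation

/-! ### The covariance operator -/

section Covariance

variable {Ω F : Type*} [MeasurableSpace Ω] [NormedAddCommGroup F] [InnerProductSpace ℝ F]

/-- The covariance operator as a continuous linear map. -/
def covCLM (ν : Measure Ω) (X : Ω → F) : F →L[ℝ] F :=
  ∫ ω, InnerProductSpace.rankOne ℝ (X ω) (X ω) ∂ν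

variable {ν : Measure Ω} [IsFiniteMeasure ν] {X : Ω → F}

lemma integrable_rankOne (hX : AEStronglyMeasurable X ν)
    (hbdd : ∃ M : ℝ, ∀ᵐ ω ∂ν, ‖X ω‖ ≤ M) :
    Integrable (fun ω => InnerProductSpace.rankOne ℝ (X ω) (X ω)) ν := by
  obtain ⟨M, hM⟩ := hbdd
  refine Integrable.of_bound ?_ (M * M) ?_
  · have hc : Continuous fun x : F => InnerProductSpace.rankOne ℝ x x :=
      (InnerProductSpace.rankOne ℝ (E := F) (F := F)).continuous₂.comp
        (continuous_id.prodMk continuous_id)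
    exact hc.comp_aestronglyMeasurable hX
  · filter_upwards [hM] with ω h
    rw [InnerProductSpace.norm_rankOne]
    exact mul_le_mul h h (norm_nonneg _) ((norm_nonneg _).trans h)

variable [CompleteSpace F]

omit [CompleteSpace F] in
lemma covCLM_apply (hX : AEStronglyMeasurable X ν) (hbdd : ∃ M : ℝ, ∀ᵐ ω ∂ν, ‖X ω‖ ≤ M) (u : F) :
    covCLM ν X u = covOp ν X u := by
  rw [covCLM, ContinuousLinearMap.integral_apply (integrable_rankOne hX hbdd)]
  rfl

lemma inner_covCLM (hX : AEStronglyMeasurable X ν) (hbdd : ∃ M : ℝ, ∀ᵐ ω ∂ν, ‖X ω‖ ≤ M) (u v : F) :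
    (inner ℝ (covCLM ν X u) v : ℝ) = ∫ ω, inner ℝ (X ω) u * inner ℝ (X ω) v ∂ν := by
  have hi := (integrable_rankOne hX hbdd).apply_continuousLinearMap u
  rw [covCLM, ContinuousLinearMap.integral_apply (integrable_rankOne hX hbdd), real_inner_comm,
    ← integral_inner hi]
  simp [inner_smul_right, real_inner_comm]

lemma covCLM_symm (hX : AEStronglyMeasurable X ν) (hbdd : ∃ M : ℝ, ∀ᵐ ω ∂ν, ‖X ω‖ ≤ M) (u v : F) :
    (inner ℝ (covCLM ν X u) v : ℝ) = inner ℝ u (covCLM ν X v) := by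
  rw [inner_covCLM hX hbdd, ← real_inner_comm, inner_covCLM hX hbdd]
  simp_rw [mul_comm]

lemma covCLM_nonneg (hX : AEStronglyMeasurable X ν) (hbdd : ∃ M : ℝ, ∀ᵐ ω ∂ν, ‖X ω‖ ≤ M) (u : F) :
    0 ≤ (inner ℝ (covCLM ν X u) u : ℝ) := by
  rw [inner_covCLM hX hbdd]
  exact integral_nonneg fun ω => mul_self_nonneg _

omit [CompleteSpace F] in
lemma isCompactOperator_rankOne (x y : F) :
    IsCompactOperator (InnerProductSpace.rankOne ℝ x y : F →L[ℝ] F) := by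
  rw [InnerProductSpace.rankOne_def']
  have h : IsCompactOperator (innerSL ℝ y : F →L[ℝ] ℝ) :=
    isCompactOperator_of_locallyCompactSpace_dom (innerSL ℝ y)
  exact h.clm_comp (ContinuousLinearMap.toSpanSingleton ℝ x)

lemma isCompactOperator_covCLM (hX : AEStronglyMeasurable X ν)
    (hbdd : ∃ M : ℝ, ∀ᵐ ω ∂ν, ‖X ω‖ ≤ M) : IsCompactOperator (covCLM ν X) := by
  by_cases hν : ν = 0
  · have : covCLM ν X = 0 := by simp [covCLM, hν]
    rw [this]; exact isCompactOperator_zero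
  have : NeZero ν := ⟨hν⟩
  -- The compact operators form a closed convex set, so an average of rank-one operators stays in
  -- it; the total mass is restored by scaling.
  have h := (compactOperator (RingHom.id ℝ) F F).convex.average_mem
    (μ := ν) (f := fun ω => InnerProductSpace.rankOne ℝ (X ω) (X ω))
    isClosed_setOfPred_isCompactOperator
    (ae_of_all _ fun ω => isCompactOperator_rankOne _ _) (integrable_rankOne hX hbdd)
  have h2 := (compactOperator (RingHom.id ℝ) F F).smul_mem (ν.real Set.univ) h
  rwa [measure_smul_average] at h2

end Covariance

/-! ### The empirical covariance operator -/

section EmpiricalCovariance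

variable {F : Type*} [NormedAddCommGroup F] [InnerProductSpace ℝ F]

/-- The empirical covariance operator as a continuous linear map. -/
def empCovCLM (x : ℕ → F) (n : ℕ) : F →L[ℝ] F :=
  (n : ℝ)⁻¹ • ∑ i ∈ Finset.range n, InnerProductSpace.rankOne ℝ (x i) (x i)

lemma empCovCLM_apply {Ω : Type*} (X : ℕ → Ω → F) (n : ℕ) (ω : Ω) (u : F) :
    empCovCLM (fun i => X i ω) n u = empCovOp X n ω u := by
  simp [empCovCLM, empCovOp]

lemma inner_empCovCLM (x : ℕ → F) (n : ℕ) (u v : F) :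
    (inner ℝ (empCovCLM x n u) v : ℝ) =
      (n : ℝ)⁻¹ * ∑ i ∈ Finset.range n, inner ℝ (x i) u * inner ℝ (x i) v := by
  simp [empCovCLM, inner_smul_left, sum_inner]

lemma empCovCLM_symm (x : ℕ → F) (n : ℕ) (u v : F) :
    (inner ℝ (empCovCLM x n u) v : ℝ) = inner ℝ u (empCovCLM x n v) := by
  rw [inner_empCovCLM, real_inner_comm, inner_empCovCLM]
  simp_rw [mul_comm]

lemma empCovCLM_nonneg (x : ℕ → F) (n : ℕ) (u : F) :
    0 ≤ (inner ℝ (empCovCLM x n u) u : ℝ) := by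
  rw [inner_empCovCLM]
  exact mul_nonneg (by positivity) (Finset.sum_nonneg fun i _ => mul_self_nonneg _)

lemma isCompactOperator_empCovCLM (x : ℕ → F) (n : ℕ) : IsCompactOperator (empCovCLM x n) :=
  (compactOperator (RingHom.id ℝ) F F).smul_mem _
    (Submodule.sum_mem _ fun i _ => isCompactOperator_rankOne (x i) (x i))

/-- Two quadratic forms are compared through their values on finitely many vectors and a bound of
the first one off the span of these. -/
lemma inner_apply_self_le_add {m : ℕ} {b : Fin m → F} (hb : Orthonormal ℝ b) {G T : F →L[ℝ] F}
    (hG : ∀ u v, (inner ℝ (G u) v : ℝ) = inner ℝ u (G v))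
    (hT : ∀ u v, (inner ℝ (T u) v : ℝ) = inner ℝ u (T v))
    (hTpos : ∀ u, 0 ≤ (inner ℝ (T u) u : ℝ)) {τ : ℝ} (u : F)
    (hτ : (inner ℝ (G (u - projector b u)) (u - projector b u) : ℝ) ≤ τ * ‖u‖ ^ 2) :
    (inner ℝ (G u) u : ℝ) ≤
      inner ℝ (T u) u + (2 * (∑ k, ‖G (b k) - T (b k)‖) + τ) * ‖u‖ ^ 2 := by
  set p := projector b u with hp
  set q := u - p with hq
  set E := G - T with hE
  have hEsymm : ∀ u v, (inner ℝ (E u) v : ℝ) = inner ℝ u (E v) := fun u v => by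
    simp [hE, inner_sub_left, inner_sub_right, hG, hT]
  have hup : u = p + q := by rw [hq]; abel
  have hpu : ‖p‖ ≤ ‖u‖ := norm_projector_le b u
  have hqu : ‖q‖ ≤ ‖u‖ := by
    have h1 := norm_sub_projector_sq hb u
    have h2 : 0 ≤ ∑ i, (inner ℝ (b i) u : ℝ) ^ 2 := Finset.sum_nonneg fun _ _ => sq_nonneg _
    exact abs_le_of_sq_le_sq' (by rw [hq, hp]; linarith) (norm_nonneg u) |>.2
  have hEp : ‖E p‖ ≤ (∑ k, ‖G (b k) - T (b k)‖) * ‖u‖ := by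
    rw [hp, projector_apply hb, map_sum, Finset.sum_mul]
    refine (norm_sum_le _ _).trans (Finset.sum_le_sum fun k _ => ?_)
    rw [map_smul, norm_smul, mul_comm]
    refine mul_le_mul_of_nonneg_left ?_ (norm_nonneg _)
    simpa [hb.norm_eq_one] using norm_inner_le_norm (𝕜 := ℝ) (b k) u
  have h1 : (inner ℝ (E u) u : ℝ) = inner ℝ (E p) u + inner ℝ (E p) q + inner ℝ (E q) q := by
    have : (inner ℝ (E q) p : ℝ) = inner ℝ (E p) q := by rw [hEsymm, real_inner_comm]
    have hEu : E u = E p + E q := by rw [← map_add, ← hup]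
    have hEq : (inner ℝ (E q) u : ℝ) = inner ℝ (E q) p + inner ℝ (E q) q := by
      rw [← inner_add_right, ← hup]
    rw [hEu, inner_add_left, hEq, this]
    ring
  have h2 : (inner ℝ (E p) u : ℝ) ≤ (∑ k, ‖G (b k) - T (b k)‖) * ‖u‖ * ‖u‖ :=
    (real_inner_le_norm _ _).trans (mul_le_mul_of_nonneg_right hEp (norm_nonneg _))
  have h3 : (inner ℝ (E p) q : ℝ) ≤ (∑ k, ‖G (b k) - T (b k)‖) * ‖u‖ * ‖u‖ :=
    (real_inner_le_norm _ _).trans (mul_le_mul hEp hqu (norm_nonneg _)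
      ((norm_nonneg _).trans hEp))
  -- Only an upper bound is sought, so the contribution of T is dropped by positivity.
  have h4 : (inner ℝ (E q) q : ℝ) ≤ τ * ‖u‖ ^ 2 := by
    rw [hE, _root_.sub_apply, inner_sub_left]
    linarith [hTpos q]
  have h5 : (inner ℝ (E u) u : ℝ) = inner ℝ (G u) u - inner ℝ (T u) u := by
    rw [hE, _root_.sub_apply, inner_sub_left]
  nlinarith

/-- Self-adjointness moves the projector from u to the data. The bound is then uniform in u and
involves a single scalar average, to which concentration applies. -/
lemma inner_empCovCLM_sub_projector_le {m : ℕ} {b : Fin m → F} (hb : Orthonormal ℝ b) (x : ℕ → F)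
    (n : ℕ) (u : F) :
    (inner ℝ (empCovCLM x n (u - projector b u)) (u - projector b u) : ℝ) ≤
      ((n : ℝ)⁻¹ * ∑ i ∈ Finset.range n, ‖x i - projector b (x i)‖ ^ 2) * ‖u‖ ^ 2 := by
  rw [inner_empCovCLM, mul_assoc, Finset.sum_mul]
  refine mul_le_mul_of_nonneg_left (Finset.sum_le_sum fun i _ => ?_) (by positivity)
  have h : (inner ℝ (x i) (u - projector b u) : ℝ) = inner ℝ (x i - projector b (x i)) u := by
    rw [inner_sub_right, inner_sub_left, projector_apply hb, projector_apply hb, inner_sum,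
      sum_inner]
    congr 1
    refine Finset.sum_congr rfl fun k _ => ?_
    rw [inner_smul_right, inner_smul_left, RCLike.conj_to_real, real_inner_comm (b k) (x i)]
    ring
  rw [h, ← sq, ← mul_pow]
  exact sq_le_sq' (neg_le_of_abs_le (abs_real_inner_le_norm _ _)) (real_inner_le_norm _ _)

end EmpiricalCovariance

/-! ### Finite-dimensional approximation of X -/

section Approximation

variable {Ω F : Type*} [MeasurableSpace Ω] [NormedAddCommGroup F] [InnerProductSpace ℝ F]
  [MeasurableSpace F] [BorelSpace F] [SecondCountableTopology F]

/-- A bounded simple function approximates X in mean square and has finite-dimensional range;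
projecting X on the span of that range is at least as good an approximation. -/
lemma exists_orthonormal_integral_sub_projector_le {P : Measure Ω} [IsProbabilityMeasure P]
    {X : Ω → F} (hX : Measurable X) (hbdd : ∃ M : ℝ, ∀ᵐ ω ∂P, ‖X ω‖ ≤ M) {δ : ℝ} (hδ : 0 < δ) :
    ∃ (m : ℕ) (b : Fin m → F), Orthonormal ℝ b ∧
      ∫ ω, ‖X ω - projector b (X ω)‖ ^ 2 ∂P ≤ δ := by
  obtain ⟨M, hM⟩ := hbdd
  have hM0 : 0 ≤ M := by
    obtain ⟨ω, hω⟩ := hM.exists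
    exact (norm_nonneg _).trans hω
  have hXs := hX.stronglyMeasurable
  have hlim : Tendsto (fun n => ∫ ω, ‖X ω - hXs.approxBounded M n ω‖ ^ 2 ∂P) atTop
      (𝓝 (∫ _, (0 : ℝ) ∂P)) := by
    refine tendsto_integral_of_dominated_convergence (fun _ => (2 * M) ^ 2)
      (fun n => ?_) (integrable_const _) (fun n => ?_) ?_
    · exact ((hXs.sub (SimpleFunc.stronglyMeasurable _)).norm.pow 2).aestronglyMeasurable
    · filter_upwards [hM] with ω h
      rw [Real.norm_of_nonneg (by positivity)]
      refine pow_le_pow_left₀ (norm_nonneg _) ((norm_sub_le _ _).trans ?_) 2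
      linarith [hXs.norm_approxBounded_le hM0 n ω]
    · filter_upwards [hXs.tendsto_approxBounded_ae hM] with ω h
      have := ((tendsto_const_nhds (x := X ω)).sub h).norm.pow 2
      simpa using this
  rw [integral_zero] at hlim
  obtain ⟨n, hn⟩ := (hlim.eventually_lt_const hδ).exists
  set g := hXs.approxBounded M n with hg
  set V := Submodule.span ℝ (Set.range g) with hV
  have hfin : FiniteDimensional ℝ V := FiniteDimensional.span_of_finite ℝ g.finite_range
  set B := stdOrthonormalBasis ℝ V with hB
  refine ⟨Module.finrank ℝ V, fun k => (B k : F), ?_, ?_⟩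
  · exact B.orthonormal.comp_linearIsometry V.subtypeₗᵢ
  have hb : Orthonormal ℝ (fun k => (B k : F)) := B.orthonormal.comp_linearIsometry V.subtypeₗᵢ
  have hfix : ∀ ω, projector (fun k => (B k : F)) (g ω) = g ω := by
    intro ω
    have hmem : g ω ∈ V := Submodule.subset_span ⟨ω, rfl⟩
    rw [projector_apply hb]
    have := congrArg Subtype.val (B.sum_repr' ⟨g ω, hmem⟩)
    simpa [Submodule.coe_inner] using this
  refine le_trans ?_ hn.le
  refine integral_mono_of_nonneg (ae_of_all _ fun _ => by positivity) ?_ (ae_of_all _ fun ω => ?_)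
  · refine Integrable.of_bound
      ((hXs.sub (SimpleFunc.stronglyMeasurable _)).norm.pow 2).aestronglyMeasurable ((2 * M) ^ 2) ?_
    filter_upwards [hM] with ω h
    rw [Real.norm_of_nonneg (by positivity)]
    refine pow_le_pow_left₀ (norm_nonneg _) ((norm_sub_le _ _).trans ?_) 2
    linarith [hXs.norm_approxBounded_le hM0 n ω]
  · show ‖X ω - projector (fun k => (B k : F)) (X ω)‖ ^ 2 ≤ ‖X ω - g ω‖ ^ 2
    have h1 := norm_sub_projector_sq hb (X ω - g ω)
    rw [map_sub, hfix, sub_sub_sub_cancel_right] at h1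
    rw [h1]
    have : 0 ≤ ∑ i, (inner ℝ (B i : F) (X ω - g ω) : ℝ) ^ 2 :=
      Finset.sum_nonneg fun _ _ => sq_nonneg _
    linarith

end Approximation

lemma tendsto_natCast_div_log_atTop :
    Tendsto (fun n : ℕ => (n : ℝ) / Real.log n) atTop atTop := by
  have h : Tendsto (fun x : ℝ => Real.log x / x) atTop (𝓝[>] 0) := by
    refine tendsto_nhdsWithin_iff.2 ⟨?_, ?_⟩
    · exact Real.isLittleO_log_id_atTop.tendsto_div_nhds_zero
    · filter_upwards [eventually_gt_atTop 1] with x hx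
      exact div_pos (Real.log_pos hx) (by linarith)
  have h2 := h.inv_tendsto_nhdsGT_zero.comp tendsto_natCast_atTop_atTop
  refine h2.congr fun n => ?_
  simp

/-! ### Rate of convergence of the empirical projector -/

section Projector

variable {Ω F : Type*} [MeasurableSpace Ω] [NormedAddCommGroup F] [InnerProductSpace ℝ F]
  [CompleteSpace F] [SecondCountableTopology F] [MeasurableSpace F] [BorelSpace F]
  {P : Measure Ω} [IsProbabilityMeasure P] {X : Ω → F} {Xs : ℕ → Ω → F}

/-- The variance of the terms does not shrink with n, so the exponential parameter is taken
proportional to the accuracy a; hence the a² in the growth condition. -/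
lemma withHighProb_norm_empCovCLM_sub_covCLM_le (hX : Measurable X) (hXs : ∀ i, Measurable (Xs i))
    (hind : iIndepFun Xs P) (hident : ∀ i, IdentDistrib (Xs i) X P P)
    (hbdd : ∃ M : ℝ, ∀ᵐ ω ∂P, ‖X ω‖ ≤ M) (v : F) {a : ℕ → ℝ}
    (ha0 : ∀ᶠ n in atTop, 0 ≤ a n) (ha1 : ∀ᶠ n in atTop, a n ≤ 1)
    (hlim : Tendsto (fun n : ℕ => n * (a n * a n) / Real.log n) atTop atTop)
    {ε : ℝ} (hε : 0 < ε) :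
    WithHighProb P fun n ω =>
      ‖empCovCLM (fun i => Xs i ω) n v - covCLM P X v‖ ≤ ε * a n := by
  have hbdd' := hbdd
  obtain ⟨M, hM⟩ := hbdd
  have h := withHighProb_norm_sum_sub_le (P := P) hXs hind hident
    (f := fun _ x => (inner ℝ x v : ℝ) • x) (fun _ => by fun_prop)
    (B := M * ‖v‖ * M) (C := ∫ ω, ‖(inner ℝ (X ω) v : ℝ) • X ω‖ ^ 2 ∂P)
    (integral_nonneg fun _ => by positivity)
    (fun _ => by
      filter_upwards [hM] with ω h
      rw [norm_smul]
      have h0 := norm_nonneg (X ω)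
      have h1 : ‖(inner ℝ (X ω) v : ℝ)‖ ≤ M * ‖v‖ :=
        (norm_inner_le_norm _ _).trans (mul_le_mul_of_nonneg_right h (norm_nonneg _))
      exact mul_le_mul h1 h h0 ((norm_nonneg _).trans h1))
    (a := a) (b := fun _ => 1) (s := a) (fun _ => zero_le_one)
    (Eventually.of_forall fun _ => by simp) ha0 ha1
    (Eventually.of_forall fun _ => by simp) hlim hε
  refine h.mono ?_
  filter_upwards [eventually_gt_atTop 0] with n hn
  refine ae_of_all _ fun ω hω => ?_
  have hn0 : (0 : ℝ) < n := by exact_mod_cast hn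
  have e : empCovCLM (fun i => Xs i ω) n v - covCLM P X v = (n : ℝ)⁻¹ •
      (∑ i ∈ Finset.range n, (inner ℝ (Xs i ω) v : ℝ) • Xs i ω -
        (n : ℝ) • ∫ ω, (inner ℝ (X ω) v : ℝ) • X ω ∂P) := by
    rw [empCovCLM_apply, covCLM_apply hX.aestronglyMeasurable hbdd', smul_sub, smul_smul,
      inv_mul_cancel₀ hn0.ne', one_smul]
    rfl
  rw [e, norm_smul, norm_inv, Real.norm_of_nonneg hn0.le, inv_mul_le_iff₀ hn0]
  linarith

/-- The quadratic form of the empirical covariance operator exceeds the one of the covariance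
operator by little. -/
lemma withHighProb_inner_empCovCLM_le (hX : Measurable X) (hXs : ∀ i, Measurable (Xs i))
    (hind : iIndepFun Xs P) (hident : ∀ i, IdentDistrib (Xs i) X P P)
    (hbdd : ∃ M : ℝ, ∀ᵐ ω ∂P, ‖X ω‖ ≤ M) {δ : ℝ} (hδ : 0 < δ) :
    WithHighProb P fun n ω => ∀ u,
      (inner ℝ (empCovCLM (fun i => Xs i ω) n u) u : ℝ) ≤
        inner ℝ (covCLM P X u) u + δ * ‖u‖ ^ 2 := by
  have hXae := hX.aestronglyMeasurable (μ := P)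
  -- Budget: δ/2 for the form off the span (δ/4 of mean, δ/4 of deviation), and δ/4, counted twice,
  -- for the vectors of the basis.
  obtain ⟨m, b, hb, hbX⟩ := exists_orthonormal_integral_sub_projector_le (P := P) hX hbdd
    (δ := δ / 4) (by positivity)
  have hlog : Tendsto (fun n : ℕ => (n : ℝ) * (1 * 1) / Real.log n) atTop atTop := by
    simpa using tendsto_natCast_div_log_atTop
  have h1 := WithHighProb.forall_fintype fun k : Fin m =>
    withHighProb_norm_empCovCLM_sub_covCLM_le hX hXs hind hident hbdd (b k) (a := fun _ => 1)
      (by simp) (by simp) hlog (ε := δ / (4 * (m + 1))) (by positivity)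
  have h2 : WithHighProb P fun n ω =>
      ‖∑ i ∈ Finset.range n, ‖Xs i ω - projector b (Xs i ω)‖ ^ 2 -
        (n : ℝ) • ∫ ω, ‖X ω - projector b (X ω)‖ ^ 2 ∂P‖ ≤ δ / 4 * (n * 1) := by
    obtain ⟨M, hM⟩ := hbdd
    refine withHighProb_norm_sum_sub_le (P := P) hXs hind hident
      (f := fun _ x => ‖x - projector b x‖ ^ 2) (fun _ => by fun_prop)
      (B := (2 * M) ^ 2) (C := ∫ ω, ‖‖X ω - projector b (X ω)‖ ^ 2‖ ^ 2 ∂P)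
      (integral_nonneg fun _ => by positivity)
      (fun _ => ?_)
      (a := fun _ => 1) (b := fun _ => 1) (s := fun _ => 1) (fun _ => zero_le_one)
      (Eventually.of_forall fun _ => by simp) (by simp) (by simp) (by simp) hlog (by positivity)
    filter_upwards [hM] with ω h
    rw [Real.norm_of_nonneg (by positivity)]
    refine pow_le_pow_left₀ (norm_nonneg _) ((norm_sub_le _ _).trans ?_) 2
    linarith [norm_projector_le b (X ω)]
  refine (h1.and h2).mono ?_
  filter_upwards [eventually_gt_atTop 0] with n hn
  refine ae_of_all _ fun ω hω u => ?_
  have hn0 : (0 : ℝ) < n := by exact_mod_cast hn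
  obtain ⟨hω1, hω2⟩ := hω
  set τ := (n : ℝ)⁻¹ * ∑ i ∈ Finset.range n, ‖Xs i ω - projector b (Xs i ω)‖ ^ 2 with hτ
  have hτle : τ ≤ δ / 2 := by
    rw [Real.norm_eq_abs, smul_eq_mul] at hω2
    rw [hτ, inv_mul_le_iff₀ hn0]
    have h3 : n * ∫ ω, ‖X ω - projector b (X ω)‖ ^ 2 ∂P ≤ n * (δ / 4) :=
      mul_le_mul_of_nonneg_left hbX hn0.le
    linarith [(abs_le.1 hω2).2]
  have hsum : ∑ k, ‖empCovCLM (fun i => Xs i ω) n (b k) - covCLM P X (b k)‖ ≤ δ / 4 := by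
    refine (Finset.sum_le_sum fun k _ => hω1 k).trans ?_
    simp only [Finset.sum_const, Finset.card_univ, Fintype.card_fin, nsmul_eq_mul, mul_one]
    rw [mul_div_assoc', div_le_div_iff₀ (by positivity) (by positivity)]
    nlinarith
  have := inner_apply_self_le_add hb (empCovCLM_symm (fun i => Xs i ω) n) (covCLM_symm hXae hbdd)
    (covCLM_nonneg hXae hbdd) u (inner_empCovCLM_sub_projector_le hb (fun i => Xs i ω) n u)
  refine this.trans (add_le_add le_rfl (mul_le_mul_of_nonneg_right ?_ (by positivity)))
  linarith

theorem withHighProb_norm_pcaProjector_sub_le (hX : Measurable X) (hXs : ∀ i, Measurable (Xs i))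
    (hind : iIndepFun Xs P) (hident : ∀ i, IdentDistrib (Xs i) X P P)
    (hbdd : ∃ M : ℝ, ∀ᵐ ω ∂P, ‖X ω‖ ≤ M) {D : ℕ} {e : Fin D → F} {lam : Fin D → ℝ}
    (he : IsLeadingEigensystem (covOp P X) e lam)
    (hsep : HasSeparatedEigenvalues (covOp P X) e lam) {Pihat : ℕ → Ω → F →L[ℝ] F}
    (hPihat : ∀ n ω, IsPCAProjector D (empCovOp Xs n ω) (Pihat n ω)) {h : ℕ → ℝ}
    (hh : ∀ n, 0 < h n) (hh0 : Tendsto h atTop (𝓝 0))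
    (hlim : Tendsto (fun n : ℕ => n * (h n * h n) / Real.log n) atTop atTop)
    {η : ℝ} (hη : 0 < η) :
    WithHighProb P fun n ω => ∀ z, ‖Pihat n ω z - projector e z‖ ≤ η * h n * ‖z‖ := by
  have hXae := hX.aestronglyMeasurable (μ := P)
  have hcov : covOp P X = covCLM P X := funext fun u => (covCLM_apply hXae hbdd u).symm
  rw [hcov] at he hsep
  obtain ⟨R, δ, hδ, hgap, hR⟩ := exists_gap_of_hasSeparatedEigenvalues (covCLM_symm hXae hbdd)
    (covCLM_nonneg hXae hbdd) (isCompactOperator_covCLM hXae hbdd) he.eigen hsep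
  -- Half of the gap absorbs the excess of the empirical form; the other half is left for the
  -- Davis–Kahan bound.
  have h1 := withHighProb_inner_empCovCLM_le hX hXs hind hident hbdd (half_pos hδ)
  -- The accuracy cancels the factor (1 + D)/(δ/2) and the sum over D residuals, leaving D/(1 + D) ≤
  -- 1 times η h.
  have h2 := WithHighProb.forall_fintype fun j : Fin D =>
    withHighProb_norm_empCovCLM_sub_covCLM_le hX hXs hind hident hbdd (e j) (a := h)
      (Eventually.of_forall fun n => (hh n).le)
      (hh0.eventually_le_const zero_lt_one) hlim
      (ε := η * (δ / 2) / ((1 + D) * (1 + D))) (by positivity)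
  refine (h1.and h2).mono (Eventually.of_forall fun n => ae_of_all _ fun ω hω z => ?_)
  obtain ⟨hω1, hω2⟩ := hω
  obtain ⟨f, μ, hf, hPf⟩ := hPihat n ω
  have hemp : empCovOp Xs n ω = empCovCLM (fun i => Xs i ω) n :=
    funext fun u => (empCovCLM_apply Xs n ω u).symm
  rw [hemp] at hf
  rw [hPf]
  have hsymm := empCovCLM_symm (fun i => Xs i ω) n
  have key := norm_projector_sub_projector_le_of_gap hsymm he.orthonormal hf.orthonormal hf.eigen
    (fun i u hu => hf.inner_apply_self_le hsymm (empCovCLM_nonneg _ n)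
      (isCompactOperator_empCovCLM _ n) i hu)
    (R := R + δ / 2) (δ := δ / 2) (half_pos hδ) (lam := lam) (fun j => by linarith [hgap j])
    (fun u hu => by
      have := hR u hu
      have := hω1 u
      linarith) z
  refine key.trans (mul_le_mul_of_nonneg_right ?_ (norm_nonneg _))
  have hsum : ∑ j, ‖empCovCLM (fun i => Xs i ω) n (e j) - lam j • e j‖ ≤
      D * (η * (δ / 2) / ((1 + D) * (1 + D)) * h n) := by
    have := Finset.sum_le_sum fun j (_ : j ∈ Finset.univ) => hω2 j
    simp_rw [he.eigen] at this
    simpa using this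
  have hD : (0 : ℝ) ≤ D := Nat.cast_nonneg D
  calc (1 + D) / (δ / 2) * ∑ j, ‖empCovCLM (fun i => Xs i ω) n (e j) - lam j • e j‖
      ≤ (1 + D) / (δ / 2) * (D * (η * (δ / 2) / ((1 + D) * (1 + D)) * h n)) :=
        mul_le_mul_of_nonneg_left hsum (by positivity)
    _ = D / (1 + D) * (η * h n) := by field_simp
    _ ≤ 1 * (η * h n) := by
        refine mul_le_mul_of_nonneg_right ?_ (mul_nonneg hη.le (hh n).le)
        rw [div_le_one (by positivity)]; linarith
    _ = η * h n := one_mul _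

end Projector

/-! ### From concentration to asymptotic equivalence -/

section Equivalence

variable {Ω : Type*} [MeasurableSpace Ω] {P : Measure Ω} [IsProbabilityMeasure P]

/-- Two sequences that concentrate at the same scale `G → ∞` are equivalent almost surely and in
second moment. -/
theorem isEquivalent_of_withHighProb {Z Z' : ℕ → Ω → ℝ} {G m : ℕ → ℝ} {c C B : ℝ}
    (hZ : ∀ n, Measurable (Z n)) (hZ' : ∀ n, Measurable (Z' n))
    (hZB : ∀ n, ∀ᵐ ω ∂P, |Z n ω| ≤ n * B) (hZB' : ∀ n, ∀ᵐ ω ∂P, |Z' n ω| ≤ n * B)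
    (hG : Tendsto G atTop atTop) (hc : 0 < c) (hC : 0 ≤ C) (hcm : ∀ᶠ n in atTop, c * G n ≤ |m n|)
    (hmC : ∀ᶠ n in atTop, |m n| ≤ C * G n) (hmean : ∀ n, ∫ ω, Z n ω ∂P = m n)
    (hZm : ∀ ε, 0 < ε → WithHighProb P fun n ω => |Z n ω - m n| ≤ ε * G n)
    (hZZ' : ∀ ε, 0 < ε → WithHighProb P fun n ω => |Z' n ω - Z n ω| ≤ ε * G n) :
    (∀ᵐ ω ∂P, (fun n => Z' n ω) ~[atTop] fun n => Z n ω) ∧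
      (fun n => ∫ ω, Z' n ω ^ 2 ∂P) ~[atTop] fun n => ∫ ω, Z n ω ^ 2 ∂P := by
  constructor
  · have h1 := (hZm (c / 2) (half_pos hc)).ae_eventually
    have h2 := ae_all_iff.2 fun k : ℕ => (hZZ' (1 / (k + 1)) (by positivity)).ae_eventually
    filter_upwards [h1, h2] with ω h1 h2
    refine isLittleO_iff.2 fun ε hε => ?_
    obtain ⟨k, hk⟩ := exists_nat_one_div_lt (show 0 < ε * (c / 2) by positivity)
    filter_upwards [h1, h2 k, hcm, hG.eventually_ge_atTop 0] with n h1 h2 h3 h4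
    have h5 : c / 2 * G n ≤ |Z n ω| := by
      have := abs_sub_abs_le_abs_sub (m n) (Z n ω)
      rw [abs_sub_comm] at this
      linarith
    rw [Pi.sub_apply, Real.norm_eq_abs, Real.norm_eq_abs]
    calc |Z' n ω - Z n ω| ≤ 1 / (k + 1) * G n := h2
      _ ≤ ε * (c / 2) * G n := mul_le_mul_of_nonneg_right hk.le h4
      _ = ε * (c / 2 * G n) := by ring
      _ ≤ ε * |Z n ω| := mul_le_mul_of_nonneg_left h5 hε.le
  · refine isLittleO_iff.2 fun ε' hε' => ?_
    -- Off the exceptional set, |Z' − Z| ≤ εG and |Z' + Z| ≤ (2C + 3)G, so this ε makes the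
    -- difference of squares at most half of ε' c² G².
    set ε := min 1 (ε' * c ^ 2 / (2 * (2 * C + 3))) with hε
    have hε0 : 0 < ε := lt_min one_pos (by positivity)
    have hε1 : ε ≤ 1 := min_le_left _ _
    have hε2 : ε * (2 * C + 3) ≤ ε' * c ^ 2 / 2 := by
      have : ε ≤ ε' * c ^ 2 / (2 * (2 * C + 3)) := min_le_right _ _
      rw [le_div_iff₀ (by positivity)] at this
      linarith
    obtain ⟨C₁, hC₁⟩ := (hZm ε hε0).and (hZZ' ε hε0)
    have hGsq : Tendsto (fun n => G n ^ 2) atTop atTop :=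
      (tendsto_pow_atTop two_ne_zero).comp hG
    filter_upwards [hC₁, hcm, hmC, hG.eventually_ge_atTop 0, eventually_gt_atTop 0,
      hGsq.eventually_ge_atTop (2 * B ^ 2 * C₁ * 2 / (ε' * c ^ 2))] with n h1 h2 h3 h4 h5 h6
    have hn0 : (0 : ℝ) < n := by exact_mod_cast h5
    set A := {ω | ¬ (|Z n ω - m n| ≤ ε * G n ∧ |Z' n ω - Z n ω| ≤ ε * G n)} with hA
    have hAm : MeasurableSet A := by
      refine MeasurableSet.compl (MeasurableSet.inter ?_ ?_)
      · exact measurableSet_le ((hZ n).sub_const _).abs measurable_const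
      · exact measurableSet_le ((hZ' n).sub (hZ n)).abs measurable_const
    have hint : ∀ {W : Ω → ℝ}, Measurable W → (∀ᵐ ω ∂P, |W ω| ≤ n * B) →
        Integrable W P ∧ Integrable (fun ω => W ω ^ 2) P := by
      intro W hW hWB
      refine ⟨Integrable.of_bound hW.aestronglyMeasurable (n * B) hWB,
        Integrable.of_bound (hW.pow_const 2).aestronglyMeasurable ((n * B) ^ 2) ?_⟩
      filter_upwards [hWB] with ω h
      rw [Real.norm_of_nonneg (by positivity), ← sq_abs]
      exact pow_le_pow_left₀ (abs_nonneg _) h 2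
    obtain ⟨hZi, hZ2i⟩ := hint (hZ n) (hZB n)
    obtain ⟨_, hZ2i'⟩ := hint (hZ' n) (hZB' n)
    -- The variance is nonnegative, so the second moment is at least the squared mean.
    have hlow : c ^ 2 * G n ^ 2 ≤ ∫ ω, Z n ω ^ 2 ∂P := by
      have e1 : 0 ≤ ∫ ω, (Z n ω - m n) ^ 2 ∂P := integral_nonneg fun _ => sq_nonneg _
      have e2 : ∫ ω, (Z n ω - m n) ^ 2 ∂P = (∫ ω, Z n ω ^ 2 ∂P) - m n ^ 2 := by
        have e3 : ∀ ω, (Z n ω - m n) ^ 2 = Z n ω ^ 2 - (2 * m n * Z n ω - m n ^ 2) :=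
          fun ω => by ring
        have e4 : ∫ ω, (2 * m n * Z n ω - m n ^ 2) ∂P = 2 * m n * m n - m n ^ 2 := by
          rw [integral_sub (hZi.const_mul _) (integrable_const _), integral_const_mul, hmean]
          simp
        have e5 : ∫ ω, (Z n ω ^ 2 - (2 * m n * Z n ω - m n ^ 2)) ∂P =
            (∫ ω, Z n ω ^ 2 ∂P) - ∫ ω, (2 * m n * Z n ω - m n ^ 2) ∂P :=
          integral_sub hZ2i ((hZi.const_mul _).sub (integrable_const _))
        simp_rw [e3]
        rw [e5, e4]
        ring
      have e5 : (c * G n) ^ 2 ≤ m n ^ 2 := by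
        rw [← sq_abs (m n)]
        exact pow_le_pow_left₀ (by positivity) h2 2
      nlinarith
    have hbound : ∀ᵐ ω ∂P, |Z' n ω ^ 2 - Z n ω ^ 2| ≤
        ε * (2 * C + 3) * G n ^ 2 + A.indicator (fun _ => 2 * (n * B) ^ 2) ω := by
      filter_upwards [hZB n, hZB' n] with ω hb hb'
      by_cases hω : ω ∈ A
      · rw [Set.indicator_of_mem hω]
        have e1 : |Z' n ω ^ 2 - Z n ω ^ 2| ≤ |Z' n ω ^ 2| + |Z n ω ^ 2| := abs_sub _ _
        rw [abs_pow, abs_pow] at e1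
        have e2 := pow_le_pow_left₀ (abs_nonneg _) hb 2
        have e3 := pow_le_pow_left₀ (abs_nonneg _) hb' 2
        have e4 : 0 ≤ ε * (2 * C + 3) * G n ^ 2 := by positivity
        linarith
      · rw [Set.indicator_of_notMem hω, add_zero]
        have hω : |Z n ω - m n| ≤ ε * G n ∧ |Z' n ω - Z n ω| ≤ ε * G n := not_not.1 hω
        have e1 : |Z n ω| ≤ (C + ε) * G n := by
          have := abs_sub_abs_le_abs_sub (Z n ω) (m n)
          linarith [hω.1]
        have e2 : |Z' n ω + Z n ω| ≤ (2 * C + 3) * G n := by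
          have e3 : Z' n ω + Z n ω = (Z' n ω - Z n ω) + 2 * Z n ω := by ring
          rw [e3]
          refine (abs_add_le _ _).trans ?_
          rw [abs_mul, abs_two]
          nlinarith [hω.2, mul_le_mul_of_nonneg_right hε1 h4]
        have e4 : Z' n ω ^ 2 - Z n ω ^ 2 = (Z' n ω - Z n ω) * (Z' n ω + Z n ω) := by ring
        rw [e4, abs_mul]
        calc _ ≤ ε * G n * ((2 * C + 3) * G n) :=
              mul_le_mul hω.2 e2 (abs_nonneg _) (by positivity)
          _ = _ := by ring
    have hupper : |(∫ ω, Z' n ω ^ 2 ∂P) - ∫ ω, Z n ω ^ 2 ∂P| ≤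
        ε * (2 * C + 3) * G n ^ 2 + P.real A * (2 * (n * B) ^ 2) := by
      rw [← integral_sub hZ2i' hZ2i]
      refine abs_integral_le_integral_abs.trans ?_
      have hii : Integrable (A.indicator fun _ => 2 * (n * B) ^ 2) P :=
        (integrable_const _).indicator hAm
      refine (integral_mono_ae (hZ2i'.sub hZ2i).abs
        ((integrable_const (ε * (2 * C + 3) * G n ^ 2)).add hii) hbound).trans_eq ?_
      simp only [Pi.add_apply]
      rw [integral_add (integrable_const _) hii, integral_indicator_const _ hAm]
      simp
    -- The n⁻² of the exceptional probability exactly offsets the trivial bound of order n²; the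
    -- resulting constant is negligible against G².
    have hA2 : P.real A * (2 * (n * B) ^ 2) ≤ 2 * B ^ 2 * C₁ := by
      calc _ ≤ C₁ / (n : ℝ) ^ 2 * (2 * (n * B) ^ 2) := mul_le_mul_of_nonneg_right h1 (by positivity)
        _ = _ := by field_simp
    rw [div_le_iff₀ (by positivity)] at h6
    rw [Pi.sub_apply, Real.norm_eq_abs, Real.norm_eq_abs, abs_of_nonneg (a := ∫ ω, Z n ω ^ 2 ∂P)
      (integral_nonneg fun _ => sq_nonneg _)]
    have h7 := mul_le_mul_of_nonneg_right hε2 (sq_nonneg (G n))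
    have h8 := mul_le_mul_of_nonneg_left hlow hε'.le
    nlinarith

end Equivalence

/-! ### Consequences of regular variation -/

section RegularVariation

/-- The limit of G(s/2)/G(s) is 2⁻ᴰ < 1/4, so halving s eventually divides G by at least 4; iterate
along dyadic scales and interpolate by monotonicity. -/
lemma RegVaryingAtZero.exists_le_sq {G : ℝ → ℝ} {D : ℕ} (hD : 2 < D) (hG : RegVaryingAtZero G D)
    (hmono : Monotone G) (h0 : ∀ s, 0 ≤ G s) (h1 : ∀ s, G s ≤ 1) :
    ∃ C s₀ : ℝ, 0 < C ∧ 0 < s₀ ∧ ∀ s, 0 < s → s ≤ s₀ → G s ≤ C * s ^ 2 := by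
  have hlt : (1 / 2 : ℝ) ^ D < 1 / 4 := by
    calc (1 / 2 : ℝ) ^ D ≤ (1 / 2) ^ 3 := pow_le_pow_of_le_one (by norm_num) (by norm_num) hD
      _ < 1 / 4 := by norm_num
  have hev := (hG (1 / 2) (by norm_num)).eventually_lt_const hlt
  obtain ⟨s₁, hs₁, hsub⟩ := mem_nhdsGT_iff_exists_Ioc_subset.1 hev
  have hs₁ : 0 < s₁ := hs₁
  have hhalf : ∀ s, 0 < s → s ≤ s₁ → G (s * (1 / 2)) ≤ G s / 4 := by
    intro s hs hs'
    have h : G (s * (1 / 2)) / G s < 1 / 4 := hsub ⟨hs, hs'⟩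
    -- Where G s = 0 the quotient is 0 by convention and carries no information; monotonicity then
    -- settles the claim.
    rcases (h0 s).eq_or_lt with hz | hp
    · have := hmono (show s * (1 / 2) ≤ s by linarith)
      linarith
    · rw [div_lt_iff₀ hp] at h
      linarith
  have hpow : ∀ k : ℕ, G (s₁ * (1 / 2) ^ k) ≤ (1 / 4) ^ k := by
    intro k
    induction k with
    | zero => simpa using h1 s₁
    | succ k ih =>
      have hk : (1 / 2 : ℝ) ^ k ≤ 1 := pow_le_one₀ (by norm_num) (by norm_num)
      have := hhalf (s₁ * (1 / 2) ^ k) (by positivity) (by nlinarith)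
      rw [pow_succ, ← mul_assoc, pow_succ]
      linarith
  -- The 4 pays for rounding s up to the next dyadic scale, less than a factor 2 before squaring.
  refine ⟨4 / s₁ ^ 2, s₁, by positivity, hs₁, fun s hs hs' => ?_⟩
  obtain ⟨k, hk1, hk2⟩ := exists_nat_pow_near_of_lt_one (x := s / s₁) (y := 1 / 2) (by positivity)
    ((div_le_one hs₁).2 hs') (by norm_num) (by norm_num)
  rw [div_le_iff₀ hs₁] at hk2
  rw [lt_div_iff₀ hs₁] at hk1
  calc G s ≤ G (s₁ * (1 / 2) ^ k) := hmono (by linarith)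
    _ ≤ (1 / 4) ^ k := hpow k
    _ = 4 / s₁ ^ 2 * ((1 / 2) ^ (k + 1) * s₁) ^ 2 := by
      have : (1 / 4 : ℝ) ^ k = ((1 / 2) ^ k) ^ 2 := by rw [← pow_mul, mul_comm, pow_mul]; norm_num
      rw [this, pow_succ]
      field_simp
      ring
    _ ≤ 4 / s₁ ^ 2 * s ^ 2 := by
      refine mul_le_mul_of_nonneg_left (pow_le_pow_left₀ (by positivity) hk1.le 2) (by positivity)

variable {Ω F : Type*} [MeasurableSpace Ω] [NormedAddCommGroup F] [InnerProductSpace ℝ F]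

lemma smallBall_mono (P : Measure Ω) [IsProbabilityMeasure P] (X : Ω → F) (Q : F →L[ℝ] F) (x : F) :
    Monotone (smallBall P X Q x) := fun _ _ h =>
  measureReal_mono fun _ hω => le_trans hω h

/-- As F_x(h) = O(h²), a window with enough sample points is also wide compared with √(ln n/n), the
estimation error of the projector. -/
lemma tendsto_sq_div_log_of_smallBall {P : Measure Ω} [IsProbabilityMeasure P] {X : Ω → F}
    {Q : F →L[ℝ] F} {x : F} {D : ℕ} (hD : 2 < D)
    (hreg : RegVaryingAtZero (smallBall P X Q x) D) {h : ℕ → ℝ} (hh : ∀ n, 0 < h n)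
    (hh0 : Tendsto h atTop (𝓝 0))
    (hlim : Tendsto (fun n : ℕ => n * smallBall P X Q x (h n) / Real.log n) atTop atTop) :
    Tendsto (fun n : ℕ => n * (h n * h n) / Real.log n) atTop atTop := by
  obtain ⟨C, s₀, hC, hs₀, hle⟩ := hreg.exists_le_sq hD (smallBall_mono P X Q x)
    (fun _ => measureReal_nonneg) (fun _ => measureReal_le_one)
  refine tendsto_atTop_mono' _ ?_ (hlim.atTop_div_const hC)
  filter_upwards [hh0.eventually_le_const hs₀, eventually_ge_atTop 1] with n hn hn1
  have hlog : 0 ≤ Real.log n := Real.log_nonneg (by exact_mod_cast hn1)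
  rw [div_le_iff₀ hC, div_mul_eq_mul_div]
  refine div_le_div_of_nonneg_right ?_ hlog
  calc (n : ℝ) * smallBall P X Q x (h n) ≤ n * (C * h n ^ 2) :=
        mul_le_mul_of_nonneg_left (hle _ (hh n) hn) (Nat.cast_nonneg n)
    _ = _ := by ring

end RegularVariation

/-! ### The kernel -/

section Kernel

variable {K : ℝ → ℝ}

lemma IsKernel.eq_zero (hK : IsKernel K) {v : ℝ} (hv : 1 < v) : K v = 0 := by
  by_contra h
  have : v ∈ Set.Icc (0 : ℝ) 1 := hK.support ▸ subset_closure ⟨by linarith, h⟩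
  linarith [this.2]

lemma IsKernel.indicator_apply (hK : IsKernel K) {v : ℝ} (hv : 0 ≤ v) :
    (Set.Icc 0 1).indicator K v = K v := by
  by_cases h : v ≤ 1
  · exact Set.indicator_of_mem (show v ∈ Set.Icc (0 : ℝ) 1 from ⟨hv, h⟩) _
  · rw [Set.indicator_of_notMem (fun h' => h h'.2), hK.eq_zero (not_le.1 h)]

/-- The values of K on negative reals are arbitrary; cutting them off yields a measurable kernel
with the same sums. -/
lemma IsKernel.indicator (hK : IsKernel K) : IsKernel ((Set.Icc 0 1).indicator K) := by
  have heq : ∀ v, 0 ≤ v → (Set.Icc 0 1).indicator K v = K v := fun _ hv => hK.indicator_apply hv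
  refine ⟨fun v hv => by rw [heq v hv]; exact hK.nonneg v hv, ?_, ?_, ?_⟩
  · obtain ⟨C, hC⟩ := hK.bounded
    exact ⟨C, fun v hv => by rw [heq v hv]; exact hC v hv⟩
  · rw [← hK.support]
    congr 1
    ext v
    exact and_congr_right fun hv => by rw [hK.support, heq v hv]
  · exact hK.contDiffOn.congr fun v hv => heq v hv.1

lemma IsKernel.measurable_indicator (hK : IsKernel K) :
    Measurable ((Set.Icc 0 1).indicator K) := by
  classical
  have := hK.contDiffOn.continuousOn.measurable_piecewise (g := 0) continuous_zero.continuousOn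
    measurableSet_Icc
  rwa [Set.piecewise_eq_indicator] at this

/-- If both arguments are at most 1, uniform continuity applies; if both exceed 1, K vanishes.
Otherwise they straddle 1, where K may jump, and a lies within η of 1. A half-open interval is used
because its mass is a difference of two closed-ball masses. -/
lemma IsKernel.exists_abs_sub_le (hK : IsKernel K) {κ : ℝ} (hκ : ∀ v, 0 ≤ v → K v ≤ κ) {ε : ℝ}
    (hε : 0 < ε) : ∃ η₀ > 0, ∀ η, η ≤ η₀ → ∀ a b : ℝ, 0 ≤ a → 0 ≤ b → |b - a| ≤ η →
      |K b - K a| ≤ ε * (Set.Iic 1).indicator 1 a +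
        κ * (Set.Ioc (1 - 2 * η) (1 + 2 * η)).indicator 1 a := by
  have hκ0 : 0 ≤ κ := (hK.nonneg 0 le_rfl).trans (hκ 0 le_rfl)
  have huc := isCompact_Icc.uniformContinuousOn_of_continuous hK.contDiffOn.continuousOn
  obtain ⟨η₁, hη₁, hη⟩ := Metric.uniformContinuousOn_iff_le.1 huc ε hε
  refine ⟨η₁, hη₁, fun η hηle a b ha hb hab => ?_⟩
  have hη0 : 0 ≤ η := (abs_nonneg _).trans hab
  have hab' := abs_le.1 hab
  have hind0 : 0 ≤ (Set.Ioc (1 - 2 * η) (1 + 2 * η)).indicator (1 : ℝ → ℝ) a :=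
    Set.indicator_nonneg (fun _ _ => zero_le_one) a
  have hind1 : 0 ≤ (Set.Iic (1 : ℝ)).indicator (1 : ℝ → ℝ) a :=
    Set.indicator_nonneg (fun _ _ => zero_le_one) a
  have hdiff : |K b - K a| ≤ κ := by
    rw [abs_le]
    constructor <;> linarith [hκ a ha, hκ b hb, hK.nonneg a ha, hK.nonneg b hb]
  have hann : a ∈ Set.Ioc (1 - 2 * η) (1 + 2 * η) → |K b - K a| ≤
      ε * (Set.Iic 1).indicator 1 a + κ * (Set.Ioc (1 - 2 * η) (1 + 2 * η)).indicator 1 a := by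
    intro h
    rw [Set.indicator_of_mem h]
    simp only [Pi.one_apply, mul_one]
    nlinarith
  by_cases ha1 : a ≤ 1
  · by_cases hb1 : b ≤ 1
    · rw [Set.indicator_of_mem (show a ∈ Set.Iic (1 : ℝ) from ha1)]
      have := hη b ⟨hb, hb1⟩ a ⟨ha, ha1⟩ (by rw [Real.dist_eq]; linarith)
      rw [Real.dist_eq] at this
      simp only [Pi.one_apply, mul_one]
      nlinarith
    · exact hann ⟨by linarith, by linarith⟩
  · by_cases hb1 : b ≤ 1
    · exact hann ⟨by linarith, by linarith⟩
    · rw [hK.eq_zero (not_le.1 ha1), hK.eq_zero (not_le.1 hb1), sub_zero, abs_zero]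
      positivity

/-- The support condition makes 1/2 a limit of points where K is nonzero; continuity at such an
interior point spreads positivity to an interval. -/
lemma IsKernel.exists_pos_on (hK : IsKernel K) :
    ∃ k a b : ℝ, 0 < k ∧ 0 < a ∧ a < b ∧ b < 1 ∧ ∀ v ∈ Set.Ioc a b, k ≤ K v := by
  have hmem : (1 / 2 : ℝ) ∈ closure {v | 0 ≤ v ∧ K v ≠ 0} := by
    rw [hK.support]; constructor <;> norm_num
  obtain ⟨v, ⟨hv0, hv⟩, hdist⟩ := Metric.mem_closure_iff.1 hmem (1 / 4) (by norm_num)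
  rw [Real.dist_eq, abs_lt] at hdist
  have hv1 : 0 < v := by linarith
  have hv2 : v < 1 := by linarith
  have hKv : 0 < K v := lt_of_le_of_ne (hK.nonneg v hv0) (Ne.symm hv)
  have hcont : ContinuousAt K v :=
    hK.contDiffOn.continuousOn.continuousAt (Icc_mem_nhds hv1 hv2)
  have hev : ∀ᶠ u in 𝓝 v, K v / 2 < K u := hcont.eventually_const_lt (by linarith)
  obtain ⟨l, u, ⟨hl, hu⟩, hlu⟩ := mem_nhds_iff_exists_Ioo_subset.1
    (hev.and (Ioo_mem_nhds hv1 hv2))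
  refine ⟨K v / 2, (max l 0 + v) / 2, (min u 1 + v) / 2, by linarith, ?_, ?_, ?_, ?_⟩
  · linarith [le_max_right l 0]
  · have := max_lt hl hv1
    have := lt_min hu hv2
    linarith
  · linarith [min_le_right u 1]
  · intro w hw
    have h1 := max_lt hl hv1
    have h2 := lt_min hu hv2
    have h3 := le_max_left l 0
    have h4 := min_le_left u 1
    exact (hlu ⟨by linarith [hw.1], by linarith [hw.2]⟩).1.le

end Kernel

/-! ### Counting sample points and comparing the two kernel sums -/

section SmallBall

variable {Ω F : Type*} [MeasurableSpace Ω] [NormedAddCommGroup F] [InnerProductSpace ℝ F]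
  {P : Measure Ω} {X : Ω → F} {Q : F →L[ℝ] F} {x : F}

lemma norm_div_le_iff {h u : ℝ} (hh : 0 < h) (y : F) :
    ‖Q (x - y)‖ / h ≤ u ↔ ‖Q y - Q x‖ ≤ h * u := by
  rw [div_le_iff₀ hh, map_sub, norm_sub_rev, mul_comm]

lemma RegVaryingAtZero.tendsto_comp {G : ℝ → ℝ} {D : ℕ} (hG : RegVaryingAtZero G D) {u : ℝ}
    (hu : 0 < u) {h : ℕ → ℝ} (hh : ∀ n, 0 < h n) (hh0 : Tendsto h atTop (𝓝 0)) :
    Tendsto (fun n => G (h n * u) / G (h n)) atTop (𝓝 (u ^ D)) :=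
  (hG u hu).comp (tendsto_nhdsWithin_iff.2 ⟨hh0, Eventually.of_forall hh⟩)

lemma tendsto_smallBall_sub_div {D : ℕ} (hreg : RegVaryingAtZero (smallBall P X Q x) D) {u v : ℝ}
    (hu : 0 < u) (hv : 0 < v) {h : ℕ → ℝ} (hh : ∀ n, 0 < h n) (hh0 : Tendsto h atTop (𝓝 0)) :
    Tendsto (fun n => (smallBall P X Q x (h n * v) - smallBall P X Q x (h n * u)) /
      smallBall P X Q x (h n)) atTop (𝓝 (v ^ D - u ^ D)) := by
  simp_rw [sub_div]
  exact (hreg.tendsto_comp hv hh hh0).sub (hreg.tendsto_comp hu hh hh0)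

lemma eventually_smallBall_pos {h : ℕ → ℝ}
    (hlim : Tendsto (fun n : ℕ => n * smallBall P X Q x (h n) / Real.log n) atTop atTop) :
    ∀ᶠ n in atTop, 0 < smallBall P X Q x (h n) := by
  filter_upwards [hlim.eventually_gt_atTop 0] with n hn
  refine lt_of_le_of_ne measureReal_nonneg fun h0 => ?_
  rw [← h0] at hn
  simp at hn

lemma tendsto_mul_smallBall {h : ℕ → ℝ}
    (hlim : Tendsto (fun n : ℕ => n * smallBall P X Q x (h n) / Real.log n) atTop atTop) :
    Tendsto (fun n : ℕ => n * smallBall P X Q x (h n)) atTop atTop := by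
  have hlog : Tendsto (fun n : ℕ => Real.log n) atTop atTop :=
    Real.tendsto_log_atTop.comp tendsto_natCast_atTop_atTop
  refine (hlim.atTop_mul_atTop₀ hlog).congr' ?_
  filter_upwards [hlog.eventually_gt_atTop 0] with n hn
  field_simp

variable [MeasurableSpace F] [BorelSpace F]

lemma integral_indicator_Iic {h : ℝ} (hh : 0 < h) (hX : Measurable X) (u : ℝ) :
    ∫ ω, (Set.Iic u).indicator (1 : ℝ → ℝ) (‖Q (x - X ω)‖ / h) ∂P = smallBall P X Q x (h * u) := by
  have hm : MeasurableSet {ω | ‖Q (x - X ω)‖ / h ≤ u} :=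
    measurableSet_le (by fun_prop) measurable_const
  have : (fun ω => (Set.Iic u).indicator (1 : ℝ → ℝ) (‖Q (x - X ω)‖ / h)) =
      {ω | ‖Q (x - X ω)‖ / h ≤ u}.indicator 1 := rfl
  rw [this, integral_indicator_one hm, smallBall]
  simp_rw [norm_div_le_iff hh]

variable [IsProbabilityMeasure P]

lemma integral_indicator_Ioc {h : ℝ} (hh : 0 < h) (hX : Measurable X) {u v : ℝ} (huv : u ≤ v) :
    ∫ ω, (Set.Ioc u v).indicator (1 : ℝ → ℝ) (‖Q (x - X ω)‖ / h) ∂P =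
      smallBall P X Q x (h * v) - smallBall P X Q x (h * u) := by
  have hi : ∀ w : ℝ, Integrable
      (fun ω => (Set.Iic w).indicator (1 : ℝ → ℝ) (‖Q (x - X ω)‖ / h)) P := by
    intro w
    refine Integrable.of_bound (Measurable.aestronglyMeasurable ?_) 1 (ae_of_all _ fun ω => ?_)
    · exact (measurable_one.indicator measurableSet_Iic).comp (by fun_prop)
    · exact (norm_indicator_le_norm_self _ _).trans (by simp)
  rw [← integral_indicator_Iic hh hX, ← integral_indicator_Iic hh hX, ← integral_sub (hi v) (hi u)]
  congr 1
  ext ω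
  generalize ‖Q (x - X ω)‖ / h = t
  rcases le_or_gt t u with h1 | h1
  · simp [Set.indicator, h1, h1.trans huv, not_lt.2 h1]
  · simp [Set.indicator, h1, not_le.2 h1]

variable {Xs : ℕ → Ω → F}

/-- A bound of the number of sample points whose distance to `x`, in units of `h n`, lies in `S`. -/
lemma withHighProb_sum_indicator_le (hXs : ∀ i, Measurable (Xs i))
    (hind : iIndepFun Xs P) (hident : ∀ i, IdentDistrib (Xs i) X P P) {h : ℕ → ℝ}
    (hlim : Tendsto (fun n : ℕ => n * smallBall P X Q x (h n) / Real.log n) atTop atTop)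
    {S : Set ℝ} (hS : MeasurableSet S) {C : ℝ} (hC : 0 ≤ C)
    (hSC : ∀ᶠ n in atTop, ∫ ω, S.indicator (1 : ℝ → ℝ) (‖Q (x - X ω)‖ / h n) ∂P ≤
      C * smallBall P X Q x (h n)) {ε : ℝ} (hε : 0 < ε) :
    WithHighProb P fun n ω => ∑ i ∈ Finset.range n,
      S.indicator (1 : ℝ → ℝ) (‖Q (x - Xs i ω)‖ / h n) ≤
        (C + ε) * (n * smallBall P X Q x (h n)) := by
  have hsq : ∀ t, ‖S.indicator (1 : ℝ → ℝ) t‖ ^ 2 = S.indicator 1 t := by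
    intro t
    by_cases ht : t ∈ S <;> simp [ht]
  have key := withHighProb_norm_sum_sub_le (P := P) hXs hind hident
    (f := fun n y => S.indicator (1 : ℝ → ℝ) (‖Q (x - y)‖ / h n))
    (fun n => (measurable_one.indicator hS).comp (by fun_prop)) (B := 1) hC
    (fun n => ae_of_all _ fun ω => (norm_indicator_le_norm_self _ _).trans (by simp))
    (a := fun n => smallBall P X Q x (h n)) (b := fun n => smallBall P X Q x (h n))
    (s := fun _ => 1) (fun _ => measureReal_nonneg)
    (by simpa only [hsq] using hSC) (by simp) (by simp) (by simp) (by simpa using hlim) hε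
  refine key.mono ?_
  filter_upwards [hSC] with n hn
  refine ae_of_all _ fun ω hω => ?_
  rw [Real.norm_eq_abs, smul_eq_mul] at hω
  have h1 := mul_le_mul_of_nonneg_left hn (Nat.cast_nonneg (α := ℝ) n)
  linarith [(abs_le.1 hω).2]

lemma withHighProb_kernelSum_sub_le [CompleteSpace F] [SecondCountableTopology F] (hX : Measurable X)
    (hXs : ∀ i, Measurable (Xs i)) (hind : iIndepFun Xs P)
    (hident : ∀ i, IdentDistrib (Xs i) X P P) {Ys : ℕ → Ω → ℝ} {M : ℝ}
    (hXM : ∀ᵐ ω ∂P, ‖X ω‖ ≤ M) (hYM : ∀ i, ∀ᵐ ω ∂P, |Ys i ω| ≤ M)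
    {D : ℕ} {e : Fin D → F} {lam : Fin D → ℝ}
    (he : IsLeadingEigensystem (covOp P X) e lam)
    (hsep : HasSeparatedEigenvalues (covOp P X) e lam) {Pihat : ℕ → Ω → F →L[ℝ] F}
    (hPihat : ∀ n ω, IsPCAProjector D (empCovOp Xs n ω) (Pihat n ω)) {K : ℝ → ℝ} (hK : IsKernel K)
    (hD : 2 < D) (hreg : RegVaryingAtZero (smallBall P X (projector e) x) D) {h : ℕ → ℝ}
    (hh : ∀ n, 0 < h n) (hh0 : Tendsto h atTop (𝓝 0))
    (hlim : Tendsto (fun n : ℕ => n * smallBall P X (projector e) x (h n) / Real.log n)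
      atTop atTop) {ε : ℝ} (hε : 0 < ε) :
    WithHighProb P fun n ω =>
      |kernelSum K Xs Ys (Pihat n ω) x (h n) n ω - kernelSum K Xs Ys (projector e) x (h n) n ω| ≤
        ε * (n * smallBall P X (projector e) x (h n)) := by
  obtain ⟨κ, hκ⟩ := hK.bounded
  have hκ0 : 0 ≤ κ := (hK.nonneg 0 le_rfl).trans (hκ 0 le_rfl)
  have hM0 : 0 ≤ M := by
    obtain ⟨ω, hω⟩ := hXM.exists
    exact (norm_nonneg _).trans hω
  set ε₁ := ε / (4 * (M + 1)) with hε₁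
  have hε₁0 : 0 < ε₁ := by positivity
  have hMε₁ : M * (ε₁ * 2) ≤ ε / 2 := by
    have : M / (M + 1) ≤ 1 := (div_le_one (by positivity)).2 (by linarith)
    calc M * (ε₁ * 2) = M / (M + 1) * (ε / 2) := by rw [hε₁]; field_simp; ring
      _ ≤ 1 * (ε / 2) := mul_le_mul_of_nonneg_right this (by positivity)
      _ = ε / 2 := one_mul _
  obtain ⟨η₀, hη₀, hKη⟩ := hK.exists_abs_sub_le hκ hε₁0
  set τ : ℝ → ℝ := fun η => (1 + 2 * η) ^ D - (1 - 2 * η) ^ D with hτ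
  have hτlim : Tendsto (fun η => M * (κ * (τ η + η + η))) (𝓝[>] 0) (𝓝 0) := by
    have : Continuous fun η => M * (κ * (τ η + η + η)) := by fun_prop
    have h0 := this.tendsto 0
    simp only [hτ] at h0 ⊢
    refine Tendsto.mono_left ?_ nhdsWithin_le_nhds
    simpa using h0
  -- The annulus mass `τ η` tends to 0 with η. The two additional η are slack, one for the
  -- small-ball limit and one for the random count.
  obtain ⟨η, hη1, hη2, hη3⟩ := ((hτlim.eventually_le_const (half_pos hε)).and
    (Ioo_mem_nhdsGT (lt_min hη₀ (show (0 : ℝ) < 1 / 4 by norm_num)))).exists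
  have hηη₀ : η ≤ η₀ := hη3.le.trans (min_le_left _ _)
  have hη4 : η < 1 / 4 := hη3.trans_le (min_le_right _ _)
  have hball := withHighProb_sum_indicator_le hXs hind hident hlim (S := Set.Iic 1)
    measurableSet_Iic zero_le_one (Eventually.of_forall fun n => by
      rw [integral_indicator_Iic (hh n) hX, mul_one, one_mul]) one_pos
  have hτ0 : 0 ≤ τ η := sub_nonneg.2 (pow_le_pow_left₀ (by linarith) (by linarith) D)
  have hann := withHighProb_sum_indicator_le hXs hind hident hlim
    (S := Set.Ioc (1 - 2 * η) (1 + 2 * η)) measurableSet_Ioc (C := τ η + η) (by positivity) (by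
      have hl := tendsto_smallBall_sub_div hreg (u := 1 - 2 * η) (v := 1 + 2 * η) (by linarith)
        (by linarith) hh hh0
      filter_upwards [hl.eventually_le_const (show τ η < τ η + η by linarith),
        eventually_smallBall_pos hlim] with n hn hpos
      rw [integral_indicator_Ioc (hh n) hX (by linarith)]
      rwa [div_le_iff₀ hpos] at hn) hη2
  -- Dividing by ‖x‖ + M + 1, which exceeds every ‖x − X_i‖ almost surely, turns the operator bound
  -- into a shift of at most η in the argument of K.
  have hproj := withHighProb_norm_pcaProjector_sub_le hX hXs hind hident ⟨M, hXM⟩ he hsep hPihat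
    hh hh0 (tendsto_sq_div_log_of_smallBall hD hreg hh hh0 hlim)
    (η := η / (‖x‖ + M + 1)) (by positivity)
  have hXsM : ∀ᵐ ω ∂P, ∀ i, ‖Xs i ω‖ ≤ M := ae_all_iff.2 fun i =>
    (hident i).symm.ae_snd (p := fun y => ‖y‖ ≤ M)
      (measurableSet_le measurable_norm measurable_const) hXM
  refine ((hball.and hann).and hproj).mono (Eventually.of_forall fun n => ?_)
  filter_upwards [hXsM, ae_all_iff.2 hYM] with ω hXω hYω hω
  obtain ⟨⟨hω1, hω2⟩, hω3⟩ := hω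
  set g := smallBall P X (projector e) x (h n) with hg
  have hg0 : 0 ≤ g := measureReal_nonneg
  have hterm : ∀ i, |Ys i ω * K (‖Pihat n ω (x - Xs i ω)‖ / h n) -
      Ys i ω * K (‖projector e (x - Xs i ω)‖ / h n)| ≤
      M * (ε₁ * (Set.Iic 1).indicator 1 (‖projector e (x - Xs i ω)‖ / h n) +
        κ * (Set.Ioc (1 - 2 * η) (1 + 2 * η)).indicator 1
          (‖projector e (x - Xs i ω)‖ / h n)) := by
    intro i
    rw [← mul_sub, abs_mul]
    refine mul_le_mul (hYω i) ?_ (abs_nonneg _) hM0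
    refine hKη η hηη₀ _ _ (div_nonneg (norm_nonneg _) (hh n).le)
      (div_nonneg (norm_nonneg _) (hh n).le) ?_
    rw [← sub_div, abs_div, abs_of_pos (hh n), div_le_iff₀ (hh n)]
    refine (abs_norm_sub_norm_le _ _).trans ((hω3 _).trans ?_)
    have hz : ‖x - Xs i ω‖ ≤ ‖x‖ + M + 1 :=
      (norm_sub_le _ _).trans (by linarith [hXω i])
    calc η / (‖x‖ + M + 1) * h n * ‖x - Xs i ω‖
        ≤ η / (‖x‖ + M + 1) * h n * (‖x‖ + M + 1) :=
          mul_le_mul_of_nonneg_left hz (mul_nonneg (by positivity) (hh n).le)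
      _ = η * h n := by field_simp
  rw [kernelSum, kernelSum, ← Finset.sum_sub_distrib]
  refine (Finset.abs_sum_le_sum_abs _ _).trans ((Finset.sum_le_sum fun i _ => hterm i).trans ?_)
  rw [← Finset.mul_sum, Finset.sum_add_distrib, ← Finset.mul_sum, ← Finset.mul_sum]
  have hng : 0 ≤ n * g := mul_nonneg (Nat.cast_nonneg n) hg0
  calc _ ≤ M * (ε₁ * ((1 + 1) * (n * g)) + κ * ((τ η + η + η) * (n * g))) := by
        refine mul_le_mul_of_nonneg_left (add_le_add ?_ ?_) hM0
        · exact mul_le_mul_of_nonneg_left hω1 hε₁0.le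
        · exact mul_le_mul_of_nonneg_left hω2 hκ0
    _ = (M * (ε₁ * 2) + M * (κ * (τ η + η + η))) * (n * g) := by ring
    _ ≤ ε * (n * g) := mul_le_mul_of_nonneg_right (by linarith) hng

end SmallBall

/-! ### Order of the mean and conclusion -/

section Main

variable {Ω F : Type*} [MeasurableSpace Ω] [NormedAddCommGroup F] [InnerProductSpace ℝ F]
  [MeasurableSpace F] [BorelSpace F] {P : Measure Ω} [IsProbabilityMeasure P] {X : Ω → F}
  {Y : Ω → ℝ}

lemma IsRegression.integral_mul_eq {Q : F →L[ℝ] F} {ρ : F → ℝ} (hρ : IsRegression P X Y Q ρ)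
    (hX : Measurable X) (hY : Integrable Y P) {g : F → ℝ} (hg : Measurable g) {B : ℝ}
    (hB : ∀ y, |g y| ≤ B) :
    Integrable (fun ω => ρ (Q (X ω)) * g (Q (X ω))) P ∧
      ∫ ω, Y ω * g (Q (X ω)) ∂P = ∫ ω, ρ (Q (X ω)) * g (Q (X ω)) ∂P := by
  have hQX : Measurable fun ω => Q (X ω) := by fun_prop
  have hle := hQX.comap_le
  have hYg : Integrable (fun ω => g (Q (X ω)) * Y ω) P :=
    hY.bdd_mul (hg.comp hQX).aestronglyMeasurable (ae_of_all _ fun ω => hB _)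
  have hgm : StronglyMeasurable[MeasurableSpace.comap (fun ω => Q (X ω)) inferInstance]
      fun ω => g (Q (X ω)) := (hg.comp (comap_measurable _)).stronglyMeasurable
  have hce := condExp_mul_of_stronglyMeasurable_left hgm hYg hY
  have hce2 : P[fun ω => g (Q (X ω)) * Y ω|
      MeasurableSpace.comap (fun ω => Q (X ω)) inferInstance] =ᵐ[P] fun ω => ρ (Q (X ω)) * g (Q (X ω)) := by
    refine hce.trans ?_
    filter_upwards [hρ.2] with ω hω
    rw [Pi.mul_apply, hω, mul_comm]
  refine ⟨integrable_condExp.congr hce2, ?_⟩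
  rw [← integral_congr_ae hce2, integral_condExp hle]
  simp_rw [mul_comm]

variable {Xs : ℕ → Ω → F} {Ys : ℕ → Ω → ℝ} {K : ℝ → ℝ} {x : F}

/-- Conditioning replaces Y by the regression function, which keeps the sign of r and at least half
its size wherever the kernel is nonzero, so no cancellation occurs. The kernel's own mean is bounded
below by an annulus on which K ≥ k, of mass comparable to F_x(h) by regular variation. -/
lemma exists_abs_integral_mul_kernel_ge (hX : Measurable X) (hY : Integrable Y P)
    (hK : IsKernel K) (hKm : Measurable K) {D : ℕ} (hD : D ≠ 0) {e : Fin D → F} {ρ : F → ℝ}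
    (hρ : IsRegression P X Y (projector e) ρ)
    (hreg : RegVaryingAtZero (smallBall P X (projector e) x) D)
    (hρx : ρ (projector e x) ≠ 0)
    (hcont : ContinuousAt (fun z => ρ (projector e z)) x) {h : ℕ → ℝ}
    (hh : ∀ n, 0 < h n) (hh0 : Tendsto h atTop (𝓝 0))
    (hlim : Tendsto (fun n : ℕ => n * smallBall P X (projector e) x (h n) / Real.log n)
      atTop atTop) :
    ∃ c, 0 < c ∧ ∀ᶠ n in atTop, c * smallBall P X (projector e) x (h n) ≤
      |∫ ω, Y ω * K (‖projector e (x - X ω)‖ / h n) ∂P| := by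
  set r := ρ (projector e x) with hr
  set Q := projector e with hQ
  obtain ⟨κ, hκ⟩ := hK.bounded
  obtain ⟨k, a, b, hk, ha, hab, hb, hkK⟩ := hK.exists_pos_on
  have hbD : 0 < b ^ D - a ^ D := sub_pos.2 (pow_lt_pow_left₀ hab ha.le hD)
  have hev : ∀ᶠ z in 𝓝 x, |ρ (Q z) - r| < |r| / 2 := by
    have := Metric.tendsto_nhds.1 hcont (|r| / 2) (half_pos (abs_pos.2 hρx))
    simpa [Real.dist_eq] using this
  obtain ⟨r₀, hr₀, hball⟩ := Metric.eventually_nhds_iff.1 hev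
  have hl := tendsto_smallBall_sub_div hreg ha (ha.trans hab) hh hh0
  refine ⟨|r| / 2 * k * ((b ^ D - a ^ D) / 2), by positivity, ?_⟩
  filter_upwards [hl.eventually_const_le (half_lt_self hbD), eventually_smallBall_pos hlim,
    hh0.eventually_lt_const hr₀] with n hn hpos hhr
  rw [le_div_iff₀ hpos] at hn
  set w : Ω → ℝ := fun ω => K (‖Q (x - X ω)‖ / h n) with hw
  have harg : ∀ ω, 0 ≤ ‖Q (x - X ω)‖ / h n := fun ω => div_nonneg (norm_nonneg _) (hh n).le
  have hw0 : ∀ ω, 0 ≤ w ω := fun ω => hK.nonneg _ (harg ω)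
  have hwm : Measurable w := hKm.comp (by fun_prop)
  have hwi : Integrable w P := by
    refine Integrable.of_bound hwm.aestronglyMeasurable κ (ae_of_all _ fun ω => ?_)
    rw [Real.norm_of_nonneg (hw0 ω)]
    exact hκ _ (harg ω)
  obtain ⟨hρi, hρeq⟩ := hρ.integral_mul_eq hX hY (g := fun y => K (‖Q x - y‖ / h n))
    (hKm.comp (by fun_prop)) (B := κ) (fun y => by
      have h0 : 0 ≤ ‖Q x - y‖ / h n := div_nonneg (norm_nonneg _) (hh n).le
      rw [abs_of_nonneg (hK.nonneg _ h0)]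
      exact hκ _ h0)
  have hwQ : ∀ ω, K (‖Q x - Q (X ω)‖ / h n) = w ω := fun ω => by rw [hw]; simp only [map_sub]
  simp_rw [hwQ] at hρi hρeq
  have hlocal : ∀ ω, r ^ 2 / 2 * w ω ≤ r * (ρ (Q (X ω)) * w ω) := by
    intro ω
    by_cases h1 : ‖Q (x - X ω)‖ / h n ≤ 1
    · rw [norm_div_le_iff (hh n), mul_one] at h1
      -- Only the projections of X and x are close, not the points. The translate of x by their
      -- difference is near x and has the projection of X.
      have h2 := hball (y := x + (Q (X ω) - Q x)) (by
        rw [dist_eq_norm, add_sub_cancel_left]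
        linarith)
      have h3 : Q (x + (Q (X ω) - Q x)) = Q (X ω) := by
        rw [map_add, map_sub, hQ, projector_projector, projector_projector]
        abel
      rw [h3] at h2
      have h4 : r ^ 2 / 2 ≤ r * ρ (Q (X ω)) := by
        have h5 : |r * (ρ (Q (X ω)) - r)| ≤ |r| * (|r| / 2) := by
          rw [abs_mul]
          exact mul_le_mul_of_nonneg_left h2.le (abs_nonneg r)
        have h6 := (abs_le.1 h5).1
        have h7 := abs_mul_abs_self r
        nlinarith
      rw [← mul_assoc]
      exact mul_le_mul_of_nonneg_right h4 (hw0 ω)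
    · have : w ω = 0 := hK.eq_zero (not_le.1 h1)
      rw [this]; simp
  have hwlow : k * (smallBall P X Q x (h n * b) - smallBall P X Q x (h n * a)) ≤ ∫ ω, w ω ∂P := by
    rw [← integral_indicator_Ioc (hh n) hX hab.le, ← integral_const_mul]
    refine integral_mono_of_nonneg (ae_of_all _ fun ω => ?_) hwi (ae_of_all _ fun ω => ?_)
    · exact mul_nonneg hk.le (Set.indicator_nonneg (fun _ _ => zero_le_one) _)
    · beta_reduce
      by_cases hmem : ‖Q (x - X ω)‖ / h n ∈ Set.Ioc a b
      · rw [Set.indicator_of_mem hmem, Pi.one_apply, mul_one]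
        exact hkK _ hmem
      · rw [Set.indicator_of_notMem hmem, mul_zero]
        exact hw0 ω
  have hmain : r ^ 2 / 2 * ∫ ω, w ω ∂P ≤ r * ∫ ω, Y ω * w ω ∂P := by
    rw [hρeq, ← integral_const_mul, ← integral_const_mul]
    exact integral_mono (hwi.const_mul _) (hρi.const_mul _) hlocal
  have habs : r * ∫ ω, Y ω * w ω ∂P ≤ |r| * |∫ ω, Y ω * w ω ∂P| := by
    rw [← abs_mul]; exact le_abs_self _
  have hrpos : 0 < |r| := abs_pos.2 hρx
  have hfin : |r| / 2 * ∫ ω, w ω ∂P ≤ |∫ ω, Y ω * w ω ∂P| := by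
    refine le_of_mul_le_mul_left ?_ hrpos
    have : |r| * (|r| / 2 * ∫ ω, w ω ∂P) = r ^ 2 / 2 * ∫ ω, w ω ∂P := by
      rw [← sq_abs r]; ring
    linarith
  refine le_trans ?_ hfin
  have h8 := mul_le_mul_of_nonneg_left hn hk.le
  have h9 := mul_le_mul_of_nonneg_left (h8.trans hwlow) (half_pos hrpos).le
  linarith

/-- The kernel sums built on the empirical and on the true projectors are equivalent. -/
theorem kernelSum_isEquivalent [CompleteSpace F] [SecondCountableTopology F]
    (hX : Measurable X) (hY : Measurable Y)
    (hXs : ∀ i, Measurable (Xs i)) (hYs : ∀ i, Measurable (Ys i))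
    (hindep : iIndepFun (fun i ω => (Xs i ω, Ys i ω)) P)
    (hident : ∀ i, IdentDistrib (fun ω => (Xs i ω, Ys i ω)) (fun ω => (X ω, Y ω)) P P)
    (hXbdd : ∃ M : ℝ, ∀ᵐ ω ∂P, ‖X ω‖ ≤ M) (hYbdd : ∃ M : ℝ, ∀ᵐ ω ∂P, |Y ω| ≤ M)
    {D : ℕ} (hD : 2 < D) {e : Fin D → F} {lam : Fin D → ℝ}
    (he : IsLeadingEigensystem (covOp P X) e lam)
    (hsep : HasSeparatedEigenvalues (covOp P X) e lam) {Pihat : ℕ → Ω → F →L[ℝ] F}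
    (hPihat : ∀ n ω, IsPCAProjector D (empCovOp Xs n ω) (Pihat n ω))
    (hPihat_meas : ∀ n v, Measurable fun ω => Pihat n ω v) (hK : IsKernel K) (hKm : Measurable K)
    {ρ : F → ℝ} (hρ : IsRegression P X Y (projector e) ρ)
    (hreg : RegVaryingAtZero (smallBall P X (projector e) x) D)
    (hρx : ρ (projector e x) ≠ 0) (hcont : ContinuousAt (fun z => ρ (projector e z)) x)
    {h : ℕ → ℝ} (hh : ∀ n, 0 < h n) (hh0 : Tendsto h atTop (𝓝 0))
    (hlim : Tendsto (fun n : ℕ => n * smallBall P X (projector e) x (h n) / Real.log n)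
      atTop atTop) :
    (∀ᵐ ω ∂P, (fun n => kernelSum K Xs Ys (Pihat n ω) x (h n) n ω) ~[atTop]
        (fun n => kernelSum K Xs Ys (projector e) x (h n) n ω)) ∧
      (fun n => ∫ ω, (kernelSum K Xs Ys (Pihat n ω) x (h n) n ω) ^ 2 ∂P) ~[atTop]
        (fun n => ∫ ω, (kernelSum K Xs Ys (projector e) x (h n) n ω) ^ 2 ∂P) := by
  obtain ⟨M₁, hM₁⟩ := hXbdd
  obtain ⟨M₂, hM₂⟩ := hYbdd
  set M := max M₁ M₂ with hM
  have hXM : ∀ᵐ ω ∂P, ‖X ω‖ ≤ M := hM₁.mono fun ω h => h.trans (le_max_left _ _)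
  have hYM : ∀ᵐ ω ∂P, |Y ω| ≤ M := hM₂.mono fun ω h => h.trans (le_max_right _ _)
  have hM0 : 0 ≤ M := by
    obtain ⟨ω, hω⟩ := hXM.exists
    exact (norm_nonneg _).trans hω
  obtain ⟨κ, hκ⟩ := hK.bounded
  have hκ0 : 0 ≤ κ := (hK.nonneg 0 le_rfl).trans (hκ 0 le_rfl)
  have hK0 : ∀ {v}, 0 ≤ v → |K v| ≤ κ := fun {v} hv => by
    rw [abs_of_nonneg (hK.nonneg v hv)]; exact hκ v hv
  have hYsM : ∀ i, ∀ᵐ ω ∂P, |Ys i ω| ≤ M := fun i =>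
    ((hident i).comp measurable_snd).symm.ae_snd (p := fun y => |y| ≤ M)
      (measurableSet_le measurable_id.abs measurable_const) hYM
  have hindX : iIndepFun Xs P := hindep.comp (fun _ z => z.1) fun _ => measurable_fst
  have hidX : ∀ i, IdentDistrib (Xs i) X P P := fun i => (hident i).comp measurable_fst
  set Q := projector e with hQ
  set g : ℕ → ℝ := fun n => smallBall P X Q x (h n) with hg
  set f : ℕ → F × ℝ → ℝ := fun n z => z.2 * K (‖Q (x - z.1)‖ / h n) with hf
  have hfm : ∀ n, Measurable (f n) := fun n =>
    measurable_snd.mul (hKm.comp (by fun_prop))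
  have hnn : ∀ n (y : F), 0 ≤ ‖Q (x - y)‖ / h n := fun n y =>
    div_nonneg (norm_nonneg _) (hh n).le
  have hfB : ∀ n, ∀ᵐ ω ∂P, ‖f n (X ω, Y ω)‖ ≤ M * κ := fun n => by
    filter_upwards [hYM] with ω h
    rw [Real.norm_eq_abs, hf, abs_mul]
    exact mul_le_mul h (hK0 (hnn n _)) (abs_nonneg _) hM0
  have hfind : ∀ n, ∀ᵐ ω ∂P, ‖f n (X ω, Y ω)‖ ≤
      M * κ * (Set.Iic 1).indicator (1 : ℝ → ℝ) (‖Q (x - X ω)‖ / h n) := fun n => by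
    filter_upwards [hfB n] with ω hω
    by_cases h1 : ‖Q (x - X ω)‖ / h n ∈ Set.Iic (1 : ℝ)
    · rw [Set.indicator_of_mem h1, Pi.one_apply, mul_one]; exact hω
    · have : f n (X ω, Y ω) = 0 := by
        rw [hf]; simp only; rw [hK.eq_zero (not_le.1 h1), mul_zero]
      rw [Set.indicator_of_notMem h1, this]; simp
  have hindi : ∀ n, Integrable (fun ω =>
      (Set.Iic 1).indicator (1 : ℝ → ℝ) (‖Q (x - X ω)‖ / h n)) P := fun n => by
    refine Integrable.of_bound (Measurable.aestronglyMeasurable ?_) 1 (ae_of_all _ fun ω => ?_)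
    · exact (measurable_one.indicator measurableSet_Iic).comp (by fun_prop)
    · exact (norm_indicator_le_norm_self _ _).trans (by simp)
  have hvar : ∀ n, ∫ ω, ‖f n (X ω, Y ω)‖ ^ 2 ∂P ≤ (M * κ) ^ 2 * g n := fun n => by
    rw [hg]
    simp only
    nth_rw 1 [← mul_one (h n)]
    rw [← integral_indicator_Iic (hh n) hX, ← integral_const_mul]
    refine integral_mono_of_nonneg (ae_of_all _ fun _ => by positivity) ((hindi n).const_mul _) ?_
    filter_upwards [hfind n] with ω hω
    refine (pow_le_pow_left₀ (norm_nonneg _) hω 2).trans_eq ?_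
    by_cases h1 : ‖Q (x - X ω)‖ / h n ∈ Set.Iic (1 : ℝ)
    · rw [Set.indicator_of_mem h1, Pi.one_apply, mul_one, mul_one]
    · rw [Set.indicator_of_notMem h1, mul_zero, mul_zero, zero_pow two_ne_zero]
  have hf1 : ∀ n, |∫ ω, f n (X ω, Y ω) ∂P| ≤ M * κ * g n := fun n => by
    rw [hg]
    simp only
    nth_rw 1 [← mul_one (h n)]
    rw [← integral_indicator_Iic (hh n) hX, ← integral_const_mul]
    exact norm_integral_le_of_norm_le ((hindi n).const_mul _) (hfind n)
  have hYi : Integrable Y P := Integrable.of_bound hY.aestronglyMeasurable M hYM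
  obtain ⟨c, hc, hcg⟩ := exists_abs_integral_mul_kernel_ge hX hYi hK hKm (by omega) hρ hreg hρx
    hcont hh hh0 hlim
  have hsumB : ∀ (n : ℕ) (R : Ω → F →L[ℝ] F),
      ∀ᵐ ω ∂P, |kernelSum K Xs Ys (R ω) x (h n) n ω| ≤ n * (M * κ) := by
    intro n R
    filter_upwards [ae_all_iff.2 hYsM] with ω hω
    refine (Finset.abs_sum_le_sum_abs _ _).trans
      ((Finset.sum_le_sum (g := fun _ => M * κ) fun i _ => ?_).trans (by simp))
    rw [abs_mul]
    exact mul_le_mul (hω i) (hK0 (div_nonneg (norm_nonneg _) (hh n).le)) (abs_nonneg _) hM0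
  have hmeasZ : ∀ n, Measurable fun ω => kernelSum K Xs Ys Q x (h n) n ω := fun n =>
    Finset.measurable_fun_sum _ fun i _ => (hYs i).mul (hKm.comp (by fun_prop))
  have hmeasZ' : ∀ n, Measurable fun ω => kernelSum K Xs Ys (Pihat n ω) x (h n) n ω := fun n => by
    refine Finset.measurable_fun_sum _ fun i _ => (hYs i).mul (hKm.comp ?_)
    refine Measurable.div_const (Measurable.norm ?_) _
    -- The random projector is evaluated at a random vector; continuity in v and measurability in ω
    -- give joint measurability.
    have hjoint : Measurable (Function.uncurry fun (v : F) (ω : Ω) => Pihat n ω v) :=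
      measurable_uncurry_of_continuous_of_measurable
        (fun ω => (Pihat n ω).continuous) (hPihat_meas n)
    exact hjoint.comp ((measurable_const.sub (hXs i)).prodMk measurable_id)
  refine isEquivalent_of_withHighProb (G := fun n => n * g n)
    (m := fun n => n * ∫ ω, f n (X ω, Y ω) ∂P) (c := c) (C := M * κ) (B := M * κ)
    hmeasZ hmeasZ' (fun n => hsumB n fun _ => Q) (fun n => hsumB n (Pihat n))
    (tendsto_mul_smallBall hlim) hc (by positivity) ?_ (Eventually.of_forall fun n => ?_)
    (fun n => ?_) (fun ε hε => ?_) (fun ε hε => ?_)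
  · filter_upwards [hcg] with n hn
    rw [abs_mul, Nat.abs_cast]
    calc c * (n * g n) = n * (c * g n) := by ring
      _ ≤ _ := mul_le_mul_of_nonneg_left hn (Nat.cast_nonneg n)
  · rw [abs_mul, Nat.abs_cast]
    calc n * |∫ ω, f n (X ω, Y ω) ∂P| ≤ n * (M * κ * g n) :=
          mul_le_mul_of_nonneg_left (hf1 n) (Nat.cast_nonneg n)
      _ = _ := by ring
  · have hid : ∀ i, IdentDistrib (fun ω => f n (Xs i ω, Ys i ω)) (fun ω => f n (X ω, Y ω)) P P :=
      fun i => (hident i).comp (hfm n)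
    have hi : Integrable (fun ω => f n (X ω, Y ω)) P :=
      Integrable.of_bound ((hfm n).comp (hX.prodMk hY)).aestronglyMeasurable _ (hfB n)
    calc ∫ ω, kernelSum K Xs Ys Q x (h n) n ω ∂P
        = ∑ i ∈ Finset.range n, ∫ ω, f n (Xs i ω, Ys i ω) ∂P :=
          integral_finsetSum _ fun i _ => (hid i).integrable_iff.2 hi
      _ = n * ∫ ω, f n (X ω, Y ω) ∂P := by
          simp [fun i => (hid i).integral_eq]
  · exact withHighProb_norm_sum_sub_le (P := P) (fun i => (hXs i).prodMk (hYs i)) hindep hident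
      hfm (C := (M * κ) ^ 2) (by positivity) hfB (a := g) (b := g) (s := fun _ => 1)
      (fun _ => measureReal_nonneg) (Eventually.of_forall hvar) (by simp) (by simp) (by simp)
      (by simpa using hlim) hε
  · exact withHighProb_kernelSum_sub_le hX hXs hindX hidX hXM hYsM he hsep hPihat hK hD hreg hh
      hh0 hlim hε

end Main

end PCA

end

theorem proposition3
    {F : Type*} [NormedAddCommGroup F] [InnerProductSpace ℝ F] [CompleteSpace F]
    [TopologicalSpace.SeparableSpace F] [MeasurableSpace F] [BorelSpace F]
    {Ω : Type*} [MeasurableSpace Ω] (P : Measure Ω) [IsProbabilityMeasure P]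
    -- the generic pair `(X, Y)` and the i.i.d. sample
    (X : Ω → F) (Y : Ω → ℝ) (hX : Measurable X) (hY : Measurable Y)
    (Xs : ℕ → Ω → F) (Ys : ℕ → Ω → ℝ)
    (hXs : ∀ i, Measurable (Xs i)) (hYs : ∀ i, Measurable (Ys i))
    (hindep : iIndepFun (fun i ω => (Xs i ω, Ys i ω)) P)
    (hident : ∀ i, IdentDistrib (fun ω => (Xs i ω, Ys i ω)) (fun ω => (X ω, Y ω)) P P)
    -- `X` is nonatomic, centered, with bounded support, and `Y` is bounded
    (hnonatomic : ∀ a : F, P {ω | X ω = a} = 0)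
    (hcentered : ∫ ω, X ω ∂P = 0)
    (hXbdd : ∃ M : ℝ, ∀ᵐ ω ∂P, ‖X ω‖ ≤ M)
    (hYbdd : ∃ M : ℝ, ∀ᵐ ω ∂P, |Y ω| ≤ M)
    -- the first `D` eigenvectors of the covariance operator
    (D : ℕ) (hD : 2 < D) (e : Fin D → F) (lam : Fin D → ℝ)
    (he : PCA.IsLeadingEigensystem (PCA.covOp P X) e lam)
    (hsep : PCA.HasSeparatedEigenvalues (PCA.covOp P X) e lam)
    -- the empirical projectors
    (Pihat : ℕ → Ω → F →L[ℝ] F)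
    (hPihat : ∀ n ω, PCA.IsPCAProjector D (PCA.empCovOp Xs n ω) (Pihat n ω))
    (hPihat_meas : ∀ n v, Measurable (fun ω => Pihat n ω v))
    -- the kernel
    (K : ℝ → ℝ) (hK : PCA.IsKernel K)
    -- a version of the regression function
    (ρ : F → ℝ) (hρ : PCA.IsRegression P X Y (PCA.projector e) ρ) :
    ∀ᵐ x ∂(P.map X),
      PCA.RegVaryingAtZero (PCA.smallBall P X (PCA.projector e) x) D →
      ρ (PCA.projector e x) ≠ 0 →
      (∃ U ∈ 𝓝 x, ∃ L : NNReal, LipschitzOnWith L (fun z => ρ (PCA.projector e z)) U) →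
      ∀ h : ℕ → ℝ, (∀ n, 0 < h n) → Tendsto h atTop (𝓝 0) →
      Tendsto (fun n : ℕ => n * PCA.smallBall P X (PCA.projector e) x (h n) / Real.log n)
        atTop atTop →
      (∀ᵐ ω ∂P,
        (fun n => PCA.kernelSum K Xs Ys (Pihat n ω) x (h n) n ω) ~[atTop]
          (fun n => PCA.kernelSum K Xs Ys (PCA.projector e) x (h n) n ω)) ∧
      (fun n => ∫ ω, (PCA.kernelSum K Xs Ys (Pihat n ω) x (h n) n ω) ^ 2 ∂P) ~[atTop]
        (fun n => ∫ ω, (PCA.kernelSum K Xs Ys (PCA.projector e) x (h n) n ω) ^ 2 ∂P) := by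
  -- The sums evaluate K only at nonnegative arguments, so the measurable cut-off kernel may replace
  -- it.
  have hK' := hK.indicator
  refine ae_of_all _ fun x hreg hρx hlip h hh hh0 hlim => ?_
  obtain ⟨U, hU, L, hL⟩ := hlip
  have hsum : ∀ (Q : F →L[ℝ] F) (n : ℕ) (ω : Ω), PCA.kernelSum K Xs Ys Q x (h n) n ω =
      PCA.kernelSum ((Set.Icc 0 1).indicator K) Xs Ys Q x (h n) n ω := fun Q n ω =>
    Finset.sum_congr rfl fun i _ => by
      rw [hK.indicator_apply (div_nonneg (norm_nonneg _) (hh n).le)]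
  simp only [hsum]
  exact PCA.kernelSum_isEquivalent hX hY hXs hYs hindep hident hXbdd hYbdd hD he hsep hPihat
    hPihat_meas hK' hK.measurable_indicator hρ hreg hρx (hL.continuousOn.continuousAt hU) hh hh0
    hlim
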